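/- **Setting.** All random variables live on one probability space $(\Omega,\mathcal A,P)$; asymptotics are for $T\to\infty$. Let $p=p(T)$ and $L=L(T)$ be integers, and $0\le s_1<\dots<s_p\le 1$ sampling points (depending on $T$). For each $T$ we observe $y_t=(X_t(s_1),\dots,X_t(s_p))^\top+u_t$, $1\le t\le T$, where the random curves $X_t=(X_t(s)\colon s\in[0,1])$ and the noise vectors $u_t=(u_{t1},\dots,u_{tp})^\top$ may depend on $T$ (suppressed in the notation); the bounds in the assumptions are uniform in $T$. Write $\|\cdot\|$ for the norm of $L^2[0,1]$. *Assumption 1 (noise).* For each $T$ the $u_t$ are i.i.d., independent of the sequence $(X_t)$, and Gaussian with mean zero and $\mathrm{Cov}(u_{ti},u_{tj})=\gamma^u(i-j)$, where $\sum_{h\in\mathbb Z}|\gamma^u(h)|\le C_u$. *Assumption 2 (signal).* (i) $(X_t)$ has mean zero and is $L^4$-$m$-approximable: $X_t=g(\delta_t,\delta_{t-1},\dots)$ a.s. with a measurable $g$ and i.i.d. $(\delta_t)_{t\in\mathbb Z}$ with values in some measurable space, and, with an independent copy $(\delta_t')$ of $(\delta_t)$, $\sum_{m\ge1}\bigl(E\|X_t-g(\delta_t,\dots,\delta_{t-m},\delta'_{t-m-1},\delta'_{t-m-2},\dots)\|^4\bigr)^{1/4}\le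 C_A$. (ii) $\sup_{s}E X_1^4(s)\le C_X$, and the covariance kernel $\Gamma^X(s,r)=\mathrm{Cov}(X_1(s),X_1(r))$ is continuous on $[0,1]^2$. (iii) $E\sup_{s}X_1^2(s)\le C_S$. (iv) Almost surely all $X_t$ lie in an $L$-dimensional space of functions on $[0,1]$. The constants $C_u,C_A,C_X,C_S<\infty$ do not depend on $T$. *Assumption 3 (eigenfunctions).* Let $\lambda_1\ge\dots\ge\lambda_L$ be the $L$ largest eigenvalues (with multiplicity) of the integral operator with kernel $\Gamma^X$, and $\varphi_1,\dots,\varphi_L$ orthonormal eigenfunctions, with $\int_0^1\Gamma^X(s,r)\varphi_\ell(r)\,dr=\lambda_\ell\varphi_\ell(s)$ for every $s$. Then $\max_{1\le k,\ell\le L}\bigl|p^{-1}\sum_{i=1}^p\varphi_k(s_i)\varphi_\ell(s_i)\bigr|=O(1)$. *Estimator.* Let $Y=(y_1,\dots,y_T)$, let $\hat\gamma_1\ge\dots\ge\hat\gamma_L$ be the $L$ largest eigenvalues of $T^{-1}Y^\top Y$, let $\hat E$ be the matrix whose columns are orthonormal eigenvectors belonging to them (any choice), and let $\hat X_t(s_j)$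 be the entry $(j,t)$ of $Y\hat E\hat E^\top$. **Theorem 2.** Let Assumptions 1--3 hold. Assume that $p\to\infty$ at a subexponential rate, in the sense that $\log p=O(T^{\kappa})$ for some $\kappa<1/2$, and that $L\to\infty$ at a subpolynomial rate, i.e. $L=o(T^{a})$ for every $a>0$. Assume that for some $\nu,\rho>0$ (not depending on $T$) $\lambda_j\ge\rho j^{-\nu}$ for all $1\le j\le L$, and that $p/\hat\gamma_L=O_P(L^\beta)$ for some $\beta>0$. Then for any $1\le t\le T$ (with constants not depending on $t$) $$\max_{1\le j\le p}|\hat X_t(s_j)-X_t(s_j)|=O_P\!\left(L^{2\beta+5/2+\nu/2}\Bigl(\frac1{T^{1/4}}+\frac{T^{1/4}}{\sqrt p}\Bigr)\right).$$ If moreover $E\|X_1\|^q$ is bounded in $T$ for some $q>4$, then for all $0<q'<q$ $$\max_{1\le t\le T}\max_{1\le j\le p}|\hat X_t(s_j)-X_t(s_j)|=o_P\!\left(L^{2\beta+5/2+\nu}\,T^{1/q'}\Bigl(\frac1{T^{1/4}}+\frac{T^{1/4}}{\sqrt p}\Bigr)\right).$$ -/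

import Mathlib

open MeasureTheory ProbabilityTheory Filter Topology Asymptotics
open scoped ENNReal NNReal Matrix

namespace FactorFDA

/-! ### Stochastic order symbols

Random quantities are `ℝ≥0∞`-valued, so that a quotient with vanishing denominator is `∞`. -/

section Order

variable {Ω : Type*} [MeasurableSpace Ω]

/-- `Z_T = O_P(r_T)` as `T → ∞`. -/
def IsBigOP (P : Measure Ω) (Z : ℕ → Ω → ℝ≥0∞) (r : ℕ → ℝ) : Prop :=
  ∀ ε : ℝ, 0 < ε → ∃ M : ℝ, 0 < M ∧
    ∀ᶠ T in atTop, P {ω | ENNReal.ofReal (M * r T) < Z T ω} ≤ ENNReal.ofReal ε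

/-- `Z_{T,t} = O_P(r_T)` as `T → ∞`, for every choice of time points `t = t_T` among the `T`
observation times (in particular for every fixed `t`): the constants do not depend on `t`. -/
def IsBigOPForEach (P : Measure Ω) (Z : (T : ℕ) → Fin T → Ω → ℝ≥0∞) (r : ℕ → ℝ) : Prop :=
  ∀ ε : ℝ, 0 < ε → ∃ M : ℝ, 0 < M ∧
    ∀ᶠ T in atTop, ∀ t : Fin T, P {ω | ENNReal.ofReal (M * r T) < Z T t ω} ≤ ENNReal.ofReal ε

/-- `Z_T = o_P(r_T)` as `T → ∞`. -/
def IsLittleOP (P : Measure Ω) (Z : ℕ → Ω → ℝ≥0∞) (r : ℕ → ℝ) : Prop :=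
  ∀ ε : ℝ, 0 < ε →
    Tendsto (fun T => P {ω | ENNReal.ofReal (ε * r T) < Z T ω}) atTop (𝓝 0)

end Order

/-! ### Growth rates -/

/-- A sequence that diverges to infinity slower than every positive power of `T`. -/
def DivergesSubpolynomially (L : ℕ → ℕ) : Prop :=
  Tendsto L atTop atTop ∧
    ∀ a : ℝ, 0 < a → (fun T => (L T : ℝ)) =o[atTop] fun T : ℕ => (T : ℝ) ^ a

/-- A sequence that diverges to infinity at a subexponential rate:
`p(T) ≤ exp (C * T ^ κ)` for large `T`, for some `C` and some `κ < 1 / 2`. -/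
def DivergesSubexponentially (p : ℕ → ℕ) : Prop :=
  Tendsto p atTop atTop ∧
    ∃ κ : ℝ, κ < 1 / 2 ∧
      (fun T => Real.log (p T)) =O[atTop] fun T : ℕ => (T : ℝ) ^ κ

/-! ### Functional time series -/

section Signal

universe w v

variable {Ω : Type w} [MeasurableSpace Ω]

/-- The `L²`-norm of a function on `[0,1]`. -/
noncomputable def normL2 (f : unitInterval → ℝ) : ℝ≥0∞ := eLpNorm f 2 volume

/-- The covariance kernel `(s, r) ↦ Cov(x(s), x(r))` of a random curve `x`. -/
noncomputable def covKernel (P : Measure Ω) (x : Ω → unitInterval → ℝ) :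
    unitInterval → unitInterval → ℝ :=
  fun s r => cov[fun ω => x ω s, fun ω => x ω r; P]

/-- The sequence `(δ_t, δ_{t-1}, δ_{t-2}, …)`. -/
def past {S : Type*} (δ : ℤ → Ω → S) (t : ℤ) (ω : Ω) : ℕ → S := fun k => δ (t - k) ω

/-- The sequence `(a_0, …, a_m, b_{m+1}, b_{m+2}, …)`. -/
def splice {S : Type*} (m : ℕ) (a b : ℕ → S) : ℕ → S := fun k => if k ≤ m then a k else b k

/-- `L^r`-`m`-approximability of a sequence of random curves, with the bound `C` for the sum of the
approximation errors over `m ≥ 1`. The independent copy of the innovations lives on the second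
factor of `Ω × Ω`. -/
def LrMApproximable (P : Measure Ω) (r : ℝ) (C : ℝ≥0∞) (X : ℕ → Ω → unitInterval → ℝ) :
    Prop :=
  ∃ (S : Type v) (_ : MeasurableSpace S) (δ : ℤ → Ω → S) (g : (ℕ → S) → unitInterval → ℝ),
    (∀ t, Measurable (δ t)) ∧ iIndepFun δ P ∧ (∀ t, IdentDistrib (δ t) (δ 0) P P) ∧
    Measurable (Function.uncurry g) ∧
    (∀ t : ℕ, ∀ᵐ ω ∂P, X t ω = g (past δ t ω)) ∧
    ∑' m : ℕ, (∫⁻ ω : Ω × Ω,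
      normL2 (g (past δ 0 ω.1) - g (splice (m + 1) (past δ 0 ω.1) (past δ 0 ω.2))) ^ r
        ∂(P.prod P)) ^ (1 / r) ≤ C

/-- Assumptions on the signals. For each sample size `T` there is a time series of random curves
`X T t`, where the index `t : ℕ` stands for the observation time `t + 1`, so that `X T 0` is the
first curve. All bounds are uniform in `T`. -/
structure SignalAssumption (P : Measure Ω) (L : ℕ → ℕ)
    (X : ℕ → ℕ → Ω → unitInterval → ℝ) : Prop where
  measurable : ∀ T t, Measurable (Function.uncurry (X T t))
  mean_zero : ∀ T s, ∫ ω, X T 0 ω s ∂P = 0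
  approximable : ∃ C : ℝ≥0, ∀ T, LrMApproximable.{w, v} P 4 C (X T)
  fourth_moment : ∃ C : ℝ≥0, ∀ T s, ∫⁻ ω, ‖X T 0 ω s‖ₑ ^ 4 ∂P ≤ C
  continuous_cov : ∀ T, Continuous (Function.uncurry (covKernel P (X T 0)))
  sup_moment : ∃ C : ℝ≥0, ∀ T, ∫⁻ ω, ⨆ s, ‖X T 0 ω s‖ₑ ^ 2 ∂P ≤ C
  finite_dim : ∀ T, ∃ V : Submodule ℝ (unitInterval → ℝ),
    Module.Finite ℝ V ∧ Module.finrank ℝ V = L T ∧ ∀ t, ∀ᵐ ω ∂P, X T t ω ∈ V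

/-- Assumptions on the noise. `u T t` is the noise vector at time `t + 1` for sample size `T`. -/
structure NoiseAssumption (P : Measure Ω) (p : ℕ → ℕ) (X : ℕ → ℕ → Ω → unitInterval → ℝ)
    (u : (T : ℕ) → ℕ → Ω → Fin (p T) → ℝ) : Prop where
  measurable : ∀ T t, Measurable (u T t)
  indep : ∀ T, iIndepFun (u T) P
  identDistrib : ∀ T t, IdentDistrib (u T t) (u T 0) P P
  gaussian : ∀ T t, HasGaussianLaw (u T t) P
  mean_zero : ∀ T t i, ∫ ω, u T t ω i ∂P = 0
  covariance : ∃ (γ : ℕ → ℤ → ℝ) (C : ℝ), ∀ T,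
    Summable (fun h => |γ T h|) ∧ ∑' h, |γ T h| ≤ C ∧
    ∀ t (i j : Fin (p T)),
      cov[fun ω => u T t ω i, fun ω => u T t ω j; P] = γ T ((i : ℤ) - (j : ℤ))
  indep_signal : ∀ T, IndepFun (fun ω t => u T t ω) (fun ω t => X T t ω) P

end Signal

/-! ### Leading eigenvalues -/

/-- `ψ ∈ L²[0,1]` satisfies `∫ K(s,r) ψ(r) dr = μ ψ(s)` for all `s`. -/
def IsEigenfunction (K : unitInterval → unitInterval → ℝ) (μ : ℝ) (ψ : unitInterval → ℝ) : Prop :=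
  MemLp ψ 2 volume ∧ ∀ s, ∫ r, K s r * ψ r = μ * ψ s

/-- `lam 0 ≥ … ≥ lam (L - 1)` are the `L` largest eigenvalues, counted with multiplicity, of the
integral operator with kernel `K`, and `φ 0, …, φ (L - 1)` are orthonormal eigenfunctions belonging
to them. -/
structure IsLeadingEigenfunctions (K : unitInterval → unitInterval → ℝ) (L : ℕ)
    (lam : ℕ → ℝ) (φ : ℕ → unitInterval → ℝ) : Prop where
  eigen : ∀ k < L, IsEigenfunction K (lam k) (φ k)
  orthonormal : ∀ k < L, ∀ l < L, ∫ s, φ k s * φ l s = if k = l then 1 else 0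
  leading : ∀ k < L, ∀ (μ : ℝ) (ψ : unitInterval → ℝ), IsEigenfunction K μ ψ →
    ∫ s, ψ s ^ 2 ≠ 0 → (∀ l < k, ∫ s, φ l s * ψ s = 0) → μ ≤ lam k

/-- `gam 0 ≥ … ≥ gam (L - 1)` are the `L` largest eigenvalues, counted with multiplicity, of the
symmetric matrix `A`, and `e 0, …, e (L - 1)` are orthonormal eigenvectors belonging to them. -/
structure IsLeadingEigenvectors {n : ℕ} (A : Matrix (Fin n) (Fin n) ℝ) (L : ℕ)
    (gam : ℕ → ℝ) (e : ℕ → Fin n → ℝ) : Prop where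
  eigen : ∀ k < L, A *ᵥ e k = gam k • e k
  orthonormal : ∀ k < L, ∀ l < L, e k ⬝ᵥ e l = if k = l then 1 else 0
  leading : ∀ k < L, ∀ (μ : ℝ) (v : Fin n → ℝ), A *ᵥ v = μ • v → v ≠ 0 →
    (∀ l < k, e l ⬝ᵥ v = 0) → μ ≤ gam k

/-! ### Data and estimator -/

/-- The `p × T` data matrix with entries `x_t(s_i) + u_{ti}`. -/
def dataMatrix {p : ℕ} (T : ℕ) (s : Fin p → unitInterval) (x : ℕ → unitInterval → ℝ)
    (u : ℕ → Fin p → ℝ) : Matrix (Fin p) (Fin T) ℝ :=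
  Matrix.of fun i t => x t (s i) + u t i

/-- The `T × T` matrix `T⁻¹ Yᵀ Y`. -/
noncomputable def gramMatrix {p T : ℕ} (Y : Matrix (Fin p) (Fin T) ℝ) :
    Matrix (Fin T) (Fin T) ℝ :=
  (T : ℝ)⁻¹ • (Yᵀ * Y)

/-- The estimator `Y E Eᵀ`, where the columns of `E` are the vectors `e 0, …, e (L - 1)`. -/
def recovered {p T : ℕ} (Y : Matrix (Fin p) (Fin T) ℝ) (L : ℕ) (e : ℕ → Fin T → ℝ) :
    Matrix (Fin p) (Fin T) ℝ :=
  let E : Matrix (Fin T) (Fin L) ℝ := Matrix.of fun t k => e k t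
  Y * E * Eᵀ

/-- The error `max_j |X̂_t(s_j) - x_t(s_j)|` at one time `t`. -/
noncomputable def maxError {p T : ℕ} (Xhat : Matrix (Fin p) (Fin T) ℝ) (s : Fin p → unitInterval)
    (x : ℕ → unitInterval → ℝ) (t : Fin T) : ℝ≥0∞ :=
  ⨆ j, ENNReal.ofReal |Xhat j t - x t (s j)|

/-- The empirical second moments of the eigenfunctions over the sampling points are bounded:
`max_{k,l ≤ L} |p⁻¹ ∑_i φ_k(s_i) φ_l(s_i)| = O(1)` as `T → ∞`. -/
def GridAssumption (p L : ℕ → ℕ) (s : (T : ℕ) → Fin (p T) → unitInterval)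
    (φ : ℕ → ℕ → unitInterval → ℝ) : Prop :=
  ∃ C : ℝ, ∀ᶠ T in atTop, ∀ k < L T, ∀ l < L T,
    |(p T : ℝ)⁻¹ * ∑ i, φ T k (s T i) * φ T l (s T i)| ≤ C

end FactorFDA

open FactorFDA

/-!
The signal matrix on the grid factorizes as `A Bᵀ`, where `A` holds the leading eigenfunctions at
the sampling points and `B` the scores of the curves; the data are `Y = A Bᵀ + U`, and the estimator
is `Y E Eᵀ`. By the eigenvector equation, `E = Yᵀ F` with `F_k = Y E_k / (T γ̂_k)`, and this
representation is used three times. It shows that the rows of `E` are of order `T ^ (-1/2)`, that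
the rows of `U` are nearly orthogonal to the columns of `E`, and that `E = B H + R` with the small
remainder `R = Uᵀ F`. The estimation error is `U E Eᵀ - A Bᵀ (1 - E Eᵀ)`. The first term is small
entrywise by the first two facts. For the second one no eigenvalue gap and no perturbation theory of
eigenspaces is needed: if `R` is small, `H` is invertible, so that the columns of `B` are, up to
`R H⁻¹`, in the column space of `E`; if `R` is not small, a trivial bound suffices
(`abs_projection_residual_le`, `abs_estimation_error_le`).

All quantities in the resulting bound are inner products of noise vectors with independent vectors,
controlled by sub-Gaussian tails, and inner products of rows of `U`, controlled by a Bernstein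
inequality for squares of Gaussian variables. They are bounded simultaneously over all times and all
sampling points (`measure_not_isTypical_le`); uniformity over the `p` points costs a factor
`T ^ (κ / 2)` with `κ < 1 / 2`, as `log p = o(T ^ κ)`. The error at time `t` is therefore at most
`T ^ (o(1)) ‖ξ_t‖ (T ^ (κ / 2 - 1 / 2) + p ^ (-1 / 2))`, with the score vector `ξ_t` of the curve
(`exists_uniform_error_bound`). This is smaller than the asserted rate by a power of `T`, which
absorbs all powers of the subpolynomial sequence `L`. The moment assumptions bound `‖ξ_t‖`, for one
`t` or for all of them.

On the side of the signal, the finite-dimensionality makes the expansion in the leading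
eigenfunctions exact at every point, with coefficients that are linear combinations of point
evaluations (`exists_scores`). The diagonal of the covariance kernel then bounds the eigenfunctions,
the lower bound on the eigenvalues entering here. Of the approximability only the stationarity of
the sequence is used (`LrMApproximable.identDistrib`).
-/

namespace FactorFDA

/-! ### Projections onto approximate column spaces -/

section LinearAlgebra

variable {m n l : Type*} [Fintype m] [Fintype n] [Fintype l]

/-- The Euclidean norm of a vector given by its coordinates. -/
noncomputable def euclNorm (v : n → ℝ) : ℝ := √(∑ i, v i ^ 2)

/-- The Frobenius norm of a matrix. -/
noncomputable def frobNorm (A : Matrix m n ℝ) : ℝ := √(∑ i, ∑ j, A i j ^ 2)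

lemma euclNorm_nonneg (v : n → ℝ) : 0 ≤ euclNorm v := Real.sqrt_nonneg _

lemma frobNorm_nonneg (A : Matrix m n ℝ) : 0 ≤ frobNorm A := Real.sqrt_nonneg _

lemma euclNorm_sq (v : n → ℝ) : euclNorm v ^ 2 = ∑ i, v i ^ 2 :=
  Real.sq_sqrt (Finset.sum_nonneg fun _ _ => sq_nonneg _)

lemma frobNorm_sq (A : Matrix m n ℝ) : frobNorm A ^ 2 = ∑ i, ∑ j, A i j ^ 2 :=
  Real.sq_sqrt (Finset.sum_nonneg fun _ _ => Finset.sum_nonneg fun _ _ => sq_nonneg _)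

lemma euclNorm_sq_eq_dotProduct (v : n → ℝ) : euclNorm v ^ 2 = v ⬝ᵥ v := by
  rw [euclNorm_sq]
  simp [dotProduct, sq]

lemma sq_dotProduct_le (v w : n → ℝ) : (v ⬝ᵥ w) ^ 2 ≤ euclNorm v ^ 2 * euclNorm w ^ 2 := by
  rw [euclNorm_sq, euclNorm_sq]
  exact Finset.sum_mul_sq_le_sq_mul_sq _ _ _

lemma abs_dotProduct_le (v w : n → ℝ) : |v ⬝ᵥ w| ≤ euclNorm v * euclNorm w :=
  abs_le_of_sq_le_sq (by simpa [mul_pow] using sq_dotProduct_le v w)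
    (mul_nonneg (euclNorm_nonneg _) (euclNorm_nonneg _))

lemma frobNorm_sq_eq_sum (A : Matrix m n ℝ) : frobNorm A ^ 2 = ∑ i, euclNorm (A i) ^ 2 := by
  simp [frobNorm_sq, euclNorm_sq]

lemma frobNorm_transpose (A : Matrix m n ℝ) : frobNorm Aᵀ = frobNorm A := by
  unfold frobNorm
  rw [Finset.sum_comm]
  rfl

lemma euclNorm_mulVec_le (A : Matrix m n ℝ) (v : n → ℝ) :
    euclNorm (A *ᵥ v) ≤ frobNorm A * euclNorm v := by
  refine le_of_sq_le_sq ?_ (mul_nonneg (frobNorm_nonneg _) (euclNorm_nonneg _))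
  rw [mul_pow, frobNorm_sq_eq_sum, euclNorm_sq, Finset.sum_mul]
  exact Finset.sum_le_sum fun i _ => sq_dotProduct_le _ _

lemma euclNorm_add_sq_le (v w : n → ℝ) :
    euclNorm (v + w) ^ 2 ≤ 2 * euclNorm v ^ 2 + 2 * euclNorm w ^ 2 := by
  simp only [euclNorm_sq, Finset.mul_sum, ← Finset.sum_add_distrib]
  refine Finset.sum_le_sum fun i _ => ?_
  simp only [Pi.add_apply]
  nlinarith [sq_nonneg (v i - w i)]

lemma euclNorm_le_of_sq_le {v : n → ℝ} {c : ℝ} (hc : 0 ≤ c) (h : ∀ i, v i ^ 2 ≤ c ^ 2) :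
    euclNorm v ≤ √(Fintype.card n) * c := by
  refine le_of_sq_le_sq ?_ (by positivity)
  rw [euclNorm_sq, mul_pow, Real.sq_sqrt (by positivity)]
  refine (Finset.sum_le_sum fun i _ => h i).trans ?_
  simp

lemma frobNorm_le_of_row_le {A : Matrix m n ℝ} {c : ℝ} (hc : 0 ≤ c)
    (h : ∀ i, euclNorm (A i) ≤ c) : frobNorm A ≤ √(Fintype.card m) * c := by
  refine le_of_sq_le_sq ?_ (by positivity)
  rw [frobNorm_sq_eq_sum, mul_pow, Real.sq_sqrt (by positivity)]
  refine (Finset.sum_le_sum fun i _ => pow_le_pow_left₀ (euclNorm_nonneg _) (h i) 2).trans ?_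
  simp

variable [DecidableEq l]

lemma euclNorm_mulVec_of_orthonormal {E : Matrix n l ℝ} (hE : Eᵀ * E = 1) (w : l → ℝ) :
    euclNorm (E *ᵥ w) = euclNorm w := by
  have : euclNorm (E *ᵥ w) ^ 2 = euclNorm w ^ 2 := by
    rw [euclNorm_sq_eq_dotProduct, euclNorm_sq_eq_dotProduct, Matrix.dotProduct_mulVec,
      ← Matrix.mulVec_transpose, Matrix.mulVec_mulVec, hE, Matrix.one_mulVec]
  exact (pow_left_inj₀ (euclNorm_nonneg _) (euclNorm_nonneg _) two_ne_zero).1 this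

lemma euclNorm_transpose_mulVec_le {E : Matrix n l ℝ} (hE : Eᵀ * E = 1) (v : n → ℝ) :
    euclNorm (Eᵀ *ᵥ v) ≤ euclNorm v := by
  refine le_of_sq_le_sq ?_ (euclNorm_nonneg _)
  have h1 : (E *ᵥ (Eᵀ *ᵥ v)) ⬝ᵥ v = euclNorm (Eᵀ *ᵥ v) ^ 2 := by
    rw [euclNorm_sq_eq_dotProduct, dotProduct_comm, Matrix.dotProduct_mulVec,
      ← Matrix.mulVec_transpose]
  have h2 : euclNorm (E *ᵥ (Eᵀ *ᵥ v)) ^ 2 = euclNorm (Eᵀ *ᵥ v) ^ 2 := by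
    rw [euclNorm_mulVec_of_orthonormal hE]
  have h3 : (0 : ℝ) ≤ euclNorm (v - E *ᵥ (Eᵀ *ᵥ v)) ^ 2 := sq_nonneg _
  rw [euclNorm_sq_eq_dotProduct, sub_dotProduct, dotProduct_sub, dotProduct_sub,
    dotProduct_comm v (E *ᵥ _), h1, ← euclNorm_sq_eq_dotProduct, ← euclNorm_sq_eq_dotProduct,
    h2] at h3
  linarith

/-- If the orthonormal columns of `E` lie, up to the small matrix `R`, in the column space of `B`,
then the part of a vector `B a` that is orthogonal to the columns of `E` has small entries. For
small `R` the matrix `H` is invertible, so that `a = H w` and `B a = E w - R w`, where the first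
summand is annihilated by the projection; for large `R` there is nothing to prove. -/
lemma abs_projection_residual_le {E R B : Matrix n l ℝ} {H : Matrix l l ℝ} (hE : Eᵀ * E = 1)
    (hER : E - R = B * H) (a : l → ℝ) (t : n) :
    |(B *ᵥ a) t - (E *ᵥ (Eᵀ *ᵥ (B *ᵥ a))) t| ≤
      2 * euclNorm a * (frobNorm B * euclNorm (R t) + frobNorm B * euclNorm (E t) * frobNorm R
        + frobNorm R * euclNorm (B t)) := by
  have ha := euclNorm_nonneg a
  have hB := frobNorm_nonneg B
  have hR := frobNorm_nonneg R
  have hRt := euclNorm_nonneg (R t)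
  have hEt := euclNorm_nonneg (E t)
  have hBt := euclNorm_nonneg (B t)
  have hBa := euclNorm_mulVec_le B a
  rcases le_or_gt (frobNorm R) (1 / 2) with hsmall | hlarge
  · have key : ∀ w, euclNorm w ≤ 2 * euclNorm (B *ᵥ (H *ᵥ w)) := by
      intro w
      have h1 : E *ᵥ w = B *ᵥ (H *ᵥ w) + R *ᵥ w := by
        rw [Matrix.mulVec_mulVec, ← hER, ← Matrix.add_mulVec, sub_add_cancel]
      have h2 := euclNorm_add_sq_le (B *ᵥ (H *ᵥ w)) (R *ᵥ w)
      rw [← h1, euclNorm_mulVec_of_orthonormal hE] at h2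
      have h3 := euclNorm_mulVec_le R w
      have h4 : euclNorm (R *ᵥ w) ^ 2 ≤ (1 / 2 * euclNorm w) ^ 2 :=
        pow_le_pow_left₀ (euclNorm_nonneg _)
          (h3.trans (mul_le_mul_of_nonneg_right hsmall (euclNorm_nonneg _))) 2
      refine le_of_sq_le_sq ?_ (mul_nonneg zero_le_two (euclNorm_nonneg _))
      nlinarith
    have hinj : Function.Injective H.mulVecLin := by
      rw [← LinearMap.ker_eq_bot, LinearMap.ker_eq_bot']
      intro w hw
      have h0 : H *ᵥ w = 0 := hw
      have h1 := key w
      have h2 : euclNorm (0 : n → ℝ) = 0 := by simp [euclNorm]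
      rw [h0, Matrix.mulVec_zero, h2, mul_zero] at h1
      have h3 : euclNorm w ^ 2 = 0 := by rw [le_antisymm h1 (euclNorm_nonneg _)]; simp
      rw [euclNorm_sq_eq_dotProduct] at h3
      exact dotProduct_self_eq_zero.1 h3
    obtain ⟨w, hw⟩ := LinearMap.injective_iff_surjective.1 hinj a
    have hw' : H *ᵥ w = a := hw
    have hwle := key w
    rw [hw'] at hwle
    have hw0 := euclNorm_nonneg w
    have hBaw : B *ᵥ a = E *ᵥ w - R *ᵥ w := by
      rw [← hw', Matrix.mulVec_mulVec, ← hER, Matrix.sub_mulVec]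
    have hres : (B *ᵥ a) t - (E *ᵥ (Eᵀ *ᵥ (B *ᵥ a))) t
        = E t ⬝ᵥ (Eᵀ *ᵥ (R *ᵥ w)) - R t ⬝ᵥ w := by
      have h5 : E *ᵥ (Eᵀ *ᵥ (B *ᵥ a)) = E *ᵥ w - E *ᵥ (Eᵀ *ᵥ (R *ᵥ w)) := by
        rw [hBaw, Matrix.mulVec_sub, Matrix.mulVec_sub, Matrix.mulVec_mulVec w Eᵀ, hE,
          Matrix.one_mulVec]
      rw [h5, hBaw]
      simp only [Pi.sub_apply]
      change (E t ⬝ᵥ w - R t ⬝ᵥ w) - (E t ⬝ᵥ w - _) = _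
      simp only [Matrix.mulVec]
      ring
    rw [hres]
    have h6 := abs_dotProduct_le (R t) w
    have h7 : |E t ⬝ᵥ (Eᵀ *ᵥ (R *ᵥ w))| ≤ euclNorm (E t) * (frobNorm R * euclNorm w) :=
      (abs_dotProduct_le _ _).trans (mul_le_mul_of_nonneg_left
        ((euclNorm_transpose_mulVec_le hE _).trans (euclNorm_mulVec_le _ _)) hEt)
    have h8 : euclNorm w ≤ 2 * (frobNorm B * euclNorm a) := hwle.trans (by linarith)
    calc |E t ⬝ᵥ (Eᵀ *ᵥ (R *ᵥ w)) - R t ⬝ᵥ w|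
        ≤ |E t ⬝ᵥ (Eᵀ *ᵥ (R *ᵥ w))| + |R t ⬝ᵥ w| := abs_sub _ _
      _ ≤ (euclNorm (R t) + euclNorm (E t) * frobNorm R) * euclNorm w := by linarith
      _ ≤ (euclNorm (R t) + euclNorm (E t) * frobNorm R) * (2 * (frobNorm B * euclNorm a)) := by
          gcongr
      _ ≤ _ := by nlinarith [mul_nonneg ha (mul_nonneg hR hBt)]
  · have h1 : |(B *ᵥ a) t| ≤ euclNorm (B t) * euclNorm a := abs_dotProduct_le _ _
    have h2 : |(E *ᵥ (Eᵀ *ᵥ (B *ᵥ a))) t| ≤ euclNorm (E t) * (frobNorm B * euclNorm a) :=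
      (abs_dotProduct_le _ _).trans (mul_le_mul_of_nonneg_left
        ((euclNorm_transpose_mulVec_le hE _).trans hBa) hEt)
    calc |(B *ᵥ a) t - (E *ᵥ (Eᵀ *ᵥ (B *ᵥ a))) t|
        ≤ |(B *ᵥ a) t| + |(E *ᵥ (Eᵀ *ᵥ (B *ᵥ a))) t| := abs_sub _ _
      _ ≤ 1 * (euclNorm a * (euclNorm (B t) + frobNorm B * euclNorm (E t))) := by linarith
      _ ≤ (2 * frobNorm R) * (euclNorm a * (euclNorm (B t) + frobNorm B * euclNorm (E t))) := by
          gcongr; linarith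
      _ ≤ _ := by nlinarith [mul_nonneg ha (mul_nonneg hB hRt)]

end LinearAlgebra

/-! ### A deterministic error bound -/

section Deterministic

variable {m n l : Type*} [Fintype m] [Fintype n] [Fintype l] [DecidableEq l]

/-- A bound for the error of the projection estimator at the entry `(j, t)` when the signal is the
low-rank matrix `A Bᵀ`, the noise is `U`, and the orthonormal columns of `E` are eigenvectors
`E_k = c_k Yᵀ Y E_k` with inverse eigenvalues `c_k ≤ d`. The eigenvector equation bounds the rows of
`E` and the vectors `Eᵀ U_j`, and it shows that the columns of `E` almost lie in the column space
of `B`. -/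
lemma abs_estimation_error_le {A : Matrix m l ℝ} {B : Matrix n l ℝ} {U Y : Matrix m n ℝ}
    {E : Matrix n l ℝ} {c : l → ℝ} {d : ℝ} (hY : Y = A * Bᵀ + U) (hE : Eᵀ * E = 1)
    (hc : ∀ k, 0 ≤ c k) (hcd : ∀ k, c k ≤ d) (hd : 0 ≤ d)
    (heig : ∀ k, E.col k = c k • ((Yᵀ * Y) *ᵥ E.col k)) {W : ℝ} (hW : 0 ≤ W)
    (hWt : ∀ t, euclNorm (Yᵀ *ᵥ U.col t) ≤ W) (j : m) (t : n) :
    |(Y * E * Eᵀ) j t - (A * Bᵀ) j t| ≤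
      Fintype.card l * d * euclNorm (Y.col t) * euclNorm (Y *ᵥ U j)
      + 2 * euclNorm (A j) * (√(Fintype.card l) * d * W) * (frobNorm B
        + frobNorm B * (√(Fintype.card l) * √d * euclNorm (Y.col t)) * √(Fintype.card n)
        + √(Fintype.card n) * euclNorm (B t)) := by
  set F : Matrix m l ℝ := Matrix.of fun i k => c k * (Y *ᵥ E.col k) i with hF
  have hFcol : ∀ k, F.col k = c k • (Y *ᵥ E.col k) := fun k => rfl
  have hEF : E = Yᵀ * F := by
    ext s k
    have h := congrFun (heig k) s
    rw [← Matrix.mulVec_mulVec, ← Matrix.mulVec_smul, ← hFcol] at h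
    exact h
  have hEcol : ∀ k, euclNorm (E.col k) ^ 2 = 1 := by
    intro k
    have h := congrFun (congrFun hE k) k
    rw [Matrix.one_apply_eq] at h
    rw [euclNorm_sq_eq_dotProduct]
    exact h
  have hYE : ∀ k, c k * euclNorm (Y *ᵥ E.col k) ^ 2 = 1 := by
    intro k
    rw [← hEcol k, euclNorm_sq_eq_dotProduct, euclNorm_sq_eq_dotProduct]
    conv_rhs => rw [heig k]
    rw [smul_dotProduct, smul_eq_mul, ← heig k, ← Matrix.mulVec_mulVec, Matrix.mulVec_transpose,
      ← Matrix.dotProduct_mulVec]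
  have hFsq : ∀ k, euclNorm (F.col k) ^ 2 ≤ d := by
    intro k
    have h : euclNorm (F.col k) ^ 2 = c k * (c k * euclNorm (Y *ᵥ E.col k) ^ 2) := by
      rw [hFcol, euclNorm_sq, euclNorm_sq, Finset.mul_sum, Finset.mul_sum]
      refine Finset.sum_congr rfl fun i _ => ?_
      simp only [Pi.smul_apply, smul_eq_mul]
      ring
    rw [h, hYE, mul_one]
    exact hcd k
  set R : Matrix n l ℝ := Uᵀ * F with hR
  have hER : E - R = B * (Aᵀ * F) := by
    rw [hR]
    nth_rewrite 1 [hEF]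
    rw [hY, Matrix.transpose_add, Matrix.transpose_mul, Matrix.transpose_transpose, Matrix.add_mul,
      add_sub_cancel_right, Matrix.mul_assoc]
  have hEt : euclNorm (E t) ≤ √(Fintype.card l) * (√d * euclNorm (Y.col t)) := by
    refine euclNorm_le_of_sq_le (mul_nonneg (Real.sqrt_nonneg _) (euclNorm_nonneg _)) fun k => ?_
    have h : E t k = Y.col t ⬝ᵥ F.col k := by
      conv_lhs => rw [hEF]
      rfl
    rw [h, mul_pow, Real.sq_sqrt hd, mul_comm d]
    exact (sq_dotProduct_le _ _).trans (mul_le_mul_of_nonneg_left (hFsq k) (sq_nonneg _))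
  have hUE : euclNorm (Eᵀ *ᵥ U j) ≤ √(Fintype.card l) * (√d * euclNorm (Y *ᵥ U j)) := by
    refine euclNorm_le_of_sq_le (mul_nonneg (Real.sqrt_nonneg _) (euclNorm_nonneg _)) fun k => ?_
    have h : (Eᵀ *ᵥ U j) k = (Y *ᵥ U j) ⬝ᵥ F.col k := by
      conv_lhs => rw [hEF, Matrix.transpose_mul, Matrix.transpose_transpose,
        ← Matrix.mulVec_mulVec]
      rw [dotProduct_comm]
      rfl
    rw [h, mul_pow, Real.sq_sqrt hd, mul_comm d]
    exact (sq_dotProduct_le _ _).trans (mul_le_mul_of_nonneg_left (hFsq k) (sq_nonneg _))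
  have hRt : ∀ s, euclNorm (R s) ≤ √(Fintype.card l) * (d * W) := by
    intro s
    refine euclNorm_le_of_sq_le (mul_nonneg hd hW) fun k => ?_
    have h : R s k = c k * ((Yᵀ *ᵥ U.col s) ⬝ᵥ E.col k) := by
      rw [Matrix.mulVec_transpose, ← Matrix.dotProduct_mulVec, ← smul_eq_mul, ← dotProduct_smul,
        ← hFcol]
      rfl
    rw [h, mul_pow, mul_pow]
    have h1 : ((Yᵀ *ᵥ U.col s) ⬝ᵥ E.col k) ^ 2 ≤ W ^ 2 := by
      refine (sq_dotProduct_le _ _).trans ?_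
      rw [hEcol, mul_one]
      exact pow_le_pow_left₀ (euclNorm_nonneg _) (hWt s) 2
    exact mul_le_mul (pow_le_pow_left₀ (hc k) (hcd k) 2) h1 (sq_nonneg _) (sq_nonneg _)
  have hRF : frobNorm R ≤ √(Fintype.card n) * (√(Fintype.card l) * (d * W)) :=
    frobNorm_le_of_row_le (by positivity) hRt
  have hres := abs_projection_residual_le hE hER (A j) t
  have hsplit : (Y * E * Eᵀ) j t - (A * Bᵀ) j t
      = (Eᵀ *ᵥ U j) ⬝ᵥ E t - ((B *ᵥ A j) t - (E *ᵥ (Eᵀ *ᵥ (B *ᵥ A j))) t) := by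
    have h1 : (A * Bᵀ) j t = (B *ᵥ A j) t := by
      simp [Matrix.mul_apply, Matrix.mulVec, dotProduct, mul_comm]
    have h2 : Y j = B *ᵥ A j + U j := by
      ext s
      rw [hY]
      simp [Matrix.mul_apply, Matrix.mulVec, dotProduct, mul_comm]
    have h3 : (Y * E * Eᵀ) j t = E t ⬝ᵥ (Eᵀ *ᵥ Y j) := by
      rw [dotProduct_comm]
      change ∑ k, (Y * E) j k * E t k = ∑ k, (Eᵀ *ᵥ Y j) k * E t k
      simp [Matrix.mul_apply, Matrix.mulVec, dotProduct, mul_comm]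
    rw [h3, h2, Matrix.mulVec_add, dotProduct_add, h1, dotProduct_comm (E t) (Eᵀ *ᵥ U j)]
    change _ = _ - (_ - E t ⬝ᵥ (Eᵀ *ᵥ (B *ᵥ A j)))
    ring
  have hAj := euclNorm_nonneg (A j)
  have hB := frobNorm_nonneg B
  have hBt := euclNorm_nonneg (B t)
  have hYt := euclNorm_nonneg (Y.col t)
  have hYU := euclNorm_nonneg (Y *ᵥ U j)
  have hEt0 := euclNorm_nonneg (E t)
  have hRF0 := frobNorm_nonneg R
  rw [hsplit]
  have hl : √(Fintype.card l : ℝ) * √(Fintype.card l) = Fintype.card l :=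
    Real.mul_self_sqrt (by positivity)
  have hdd : √d * √d = d := Real.mul_self_sqrt hd
  have hfirst : |(Eᵀ *ᵥ U j) ⬝ᵥ E t| ≤
      Fintype.card l * d * euclNorm (Y.col t) * euclNorm (Y *ᵥ U j) := by
    calc |(Eᵀ *ᵥ U j) ⬝ᵥ E t| ≤ euclNorm (Eᵀ *ᵥ U j) * euclNorm (E t) := abs_dotProduct_le _ _
      _ ≤ (√(Fintype.card l) * (√d * euclNorm (Y *ᵥ U j)))
            * (√(Fintype.card l) * (√d * euclNorm (Y.col t))) := by gcongr
      _ = (√(Fintype.card l : ℝ) * √(Fintype.card l)) * (√d * √d) * euclNorm (Y.col t)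
            * euclNorm (Y *ᵥ U j) := by ring
      _ = _ := by rw [hl, hdd]
  have hsecond : frobNorm B * euclNorm (R t) + frobNorm B * euclNorm (E t) * frobNorm R
        + frobNorm R * euclNorm (B t) ≤ (√(Fintype.card l) * d * W) * (frobNorm B
        + frobNorm B * (√(Fintype.card l) * √d * euclNorm (Y.col t)) * √(Fintype.card n)
        + √(Fintype.card n) * euclNorm (B t)) := by
    calc _ ≤ frobNorm B * (√(Fintype.card l) * (d * W))
          + frobNorm B * (√(Fintype.card l) * (√d * euclNorm (Y.col t)))
            * (√(Fintype.card n) * (√(Fintype.card l) * (d * W)))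
          + (√(Fintype.card n) * (√(Fintype.card l) * (d * W))) * euclNorm (B t) := by
          gcongr
          exact hRt t
      _ = _ := by ring
  refine (abs_sub _ _).trans (add_le_add hfirst (hres.trans ?_))
  rw [mul_assoc (2 * euclNorm (A j))]
  exact mul_le_mul_of_nonneg_left hsecond (by positivity)

end Deterministic

section Rates

variable {p T L : ℕ}

/-- Data configurations `A Bᵀ + U` for which the error bound holds at scale `τ`. The inner products
of noise vectors with independent vectors, and the deviations of the products of the rows of `U`
from their means `T * Γ`, have the size that independence provides, up to the factor `τ` for
columns and `θ` for rows; `θ` is the price of uniformity over the `p` sampling points. -/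
structure IsTypical (A : Matrix (Fin p) (Fin L) ℝ) (B : Matrix (Fin T) (Fin L) ℝ)
    (U : Matrix (Fin p) (Fin T) ℝ) (Γ : Fin p → Fin p → ℝ) (τ θ : ℝ) : Prop where
  scores : frobNorm B ≤ τ * √T
  row_signal : ∀ i j, |(A * Bᵀ) i ⬝ᵥ U j| ≤ θ * euclNorm ((A * Bᵀ) i)
  row_noise : ∀ i j, |U i ⬝ᵥ U j - T * Γ i j| ≤ √T * θ
  col_signal : ∀ r t, |(A * Bᵀ).col r ⬝ᵥ U.col t| ≤ τ * euclNorm ((A * Bᵀ).col r)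
  col_noise : ∀ r t, r ≠ t → |U.col r ⬝ᵥ U.col t| ≤ τ * euclNorm (U.col r)
  noise_norm : ∀ t, euclNorm (U.col t) ≤ τ * √p

/-- The right-hand side of `abs_estimation_error_le` on typical data, with `S = √T`, `Q = √p` and
`d = τ / (T p)`; the variables stand for the norms and dimensions that occur in it. -/
lemma scalar_error_le {S Q τ θ h l l₁ l₂ y v b b₁ a : ℝ} (hS : 0 < S) (hQ : 0 < Q) (hτ : 1 ≤ τ)
    (hθ : 1 ≤ θ) (hh : 1 ≤ h) (hl : l ≤ τ) (hl0 : 0 ≤ l₁) (hl₁ : l₁ ≤ τ) (hl₂0 : 0 ≤ l₂)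
    (hl₂ : l₁ * l₂ ≤ τ / (S * Q)) (hy0 : 0 ≤ y) (hy : y ≤ 2 * τ * Q * h) (hv0 : 0 ≤ v)
    (hv : v ≤ 3 * τ ^ 2 * (θ * (Q * S) + S ^ 2)) (hb0 : 0 ≤ b) (hb : b ≤ τ * S)
    (hb₁0 : 0 ≤ b₁) (hb₁ : b₁ ≤ h) (ha : a ≤ τ) :
    l * (τ / (S ^ 2 * Q ^ 2)) * y * v
      + 2 * a * (l₁ * (τ / (S ^ 2 * Q ^ 2)) * (2 * τ ^ 3 * (Q * S + Q ^ 2)))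
        * (b + b * (l₁ * l₂ * y) * S + S * b₁) ≤ 22 * τ ^ 9 * h * (θ / S + 1 / Q) := by
  have hτ0 : 0 < τ := by linarith
  have hθ0 : 0 < θ := by linarith
  have hh0 : 0 < h := by linarith
  have hfirst : l * (τ / (S ^ 2 * Q ^ 2)) * y * v ≤ 6 * τ ^ 5 * h * (θ / S + 1 / Q) := by
    calc _ ≤ τ * (τ / (S ^ 2 * Q ^ 2)) * (2 * τ * Q * h)
          * (3 * τ ^ 2 * (θ * (Q * S) + S ^ 2)) := by gcongr
      _ = _ := by
          field_simp
          ring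
  have hbr : b + b * (l₁ * l₂ * y) * S + S * b₁ ≤ 4 * τ ^ 3 * S * h := by
    have h3 : τ ≤ τ ^ 3 := le_self_pow₀ hτ (by norm_num)
    have h1 : 1 ≤ τ ^ 3 := one_le_pow₀ hτ
    calc _ ≤ τ * S + τ * S * (τ / (S * Q) * (2 * τ * Q * h)) * S + S * h := by gcongr
      _ = τ * S * 1 + 2 * τ ^ 3 * S * h + 1 * S * h := by
          field_simp
      _ ≤ τ ^ 3 * S * h + 2 * τ ^ 3 * S * h + τ ^ 3 * S * h := by gcongr
      _ = _ := by ring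
  have hsecond : 2 * a * (l₁ * (τ / (S ^ 2 * Q ^ 2)) * (2 * τ ^ 3 * (Q * S + Q ^ 2)))
        * (b + b * (l₁ * l₂ * y) * S + S * b₁) ≤ 16 * τ ^ 9 * h * (1 / S + 1 / Q) := by
    calc _ ≤ 2 * τ * (τ * (τ / (S ^ 2 * Q ^ 2)) * (2 * τ ^ 3 * (Q * S + Q ^ 2)))
          * (4 * τ ^ 3 * S * h) := by gcongr
      _ = _ := by
          field_simp
          ring
  have h5 : τ ^ 5 ≤ τ ^ 9 := pow_le_pow_right₀ hτ (by norm_num)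
  calc _ ≤ 6 * τ ^ 5 * h * (θ / S + 1 / Q) + 16 * τ ^ 9 * h * (1 / S + 1 / Q) :=
        add_le_add hfirst hsecond
    _ ≤ 6 * τ ^ 9 * h * (θ / S + 1 / Q) + 16 * τ ^ 9 * h * (θ / S + 1 / Q) := by gcongr
    _ = _ := by ring

set_option maxHeartbeats 800000 in
/-- The deterministic error bound, evaluated on typical data. -/
lemma IsTypical.abs_error_le {A : Matrix (Fin p) (Fin L) ℝ} {B : Matrix (Fin T) (Fin L) ℝ}
    {U : Matrix (Fin p) (Fin T) ℝ} {Γ : Fin p → Fin p → ℝ} {τ θ h : ℝ}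
    (htyp : IsTypical A B U Γ τ θ) (hp : 0 < p) (hT : 0 < T) (hτ : 1 ≤ τ) (hθ : 1 ≤ θ)
    (hh : 1 ≤ h) (hL : L ≤ τ) (hA : ∀ j, euclNorm (A j) ≤ τ)
    (hgrid : ∀ b, euclNorm (A *ᵥ b) ≤ τ * √p * euclNorm b)
    (hΓ : ∀ j, ∑ i, Γ i j ^ 2 ≤ τ)
    {E : Matrix (Fin T) (Fin L) ℝ} {c : Fin L → ℝ} (hE : Eᵀ * E = 1)
    (hc : ∀ k, 0 ≤ c k) (hcd : ∀ k, c k ≤ τ / (T * p))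
    (heig : ∀ k, E.col k = c k • (((A * Bᵀ + U)ᵀ * (A * Bᵀ + U)) *ᵥ E.col k))
    (j : Fin p) (t : Fin T) (hB : euclNorm (B t) ≤ h) :
    |((A * Bᵀ + U) * E * Eᵀ) j t - (A * Bᵀ) j t| ≤ 22 * τ ^ 9 * h * (θ / √T + 1 / √p) := by
  set Y := A * Bᵀ + U with hY
  set S := √(T : ℝ) with hS
  set Q := √(p : ℝ) with hQ
  have hS0 : 0 < S := Real.sqrt_pos.2 (by exact_mod_cast hT)
  have hQ0 : 0 < Q := Real.sqrt_pos.2 (by exact_mod_cast hp)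
  have hTS : (T : ℝ) = S ^ 2 := (Real.sq_sqrt (by positivity)).symm
  have hpQ : (p : ℝ) = Q ^ 2 := (Real.sq_sqrt (by positivity)).symm
  have hτ0 : 0 < τ := by linarith
  have hθ0 : 0 < θ := by linarith
  have hh0 : 0 < h := by linarith
  have hYcol : ∀ r, Y.col r = (A * Bᵀ).col r + U.col r := fun r => rfl
  have hXF : frobNorm (A * Bᵀ) ≤ τ ^ 2 * (Q * S) := by
    refine le_of_sq_le_sq ?_ (by positivity)
    rw [← frobNorm_transpose, frobNorm_sq_eq_sum]
    calc ∑ r, euclNorm ((A * Bᵀ)ᵀ r) ^ 2 ≤ ∑ r, (τ * Q) ^ 2 * euclNorm (B r) ^ 2 := by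
          refine Finset.sum_le_sum fun r _ => ?_
          rw [← mul_pow]
          exact pow_le_pow_left₀ (euclNorm_nonneg _) (hgrid (B r)) 2
      _ = (τ * Q) ^ 2 * frobNorm B ^ 2 := by rw [frobNorm_sq_eq_sum, Finset.mul_sum]
      _ ≤ (τ * Q) ^ 2 * (τ * S) ^ 2 := by
          gcongr
          · exact frobNorm_nonneg _
          · exact htyp.scores
      _ = _ := by ring
  have hXF2 : frobNorm (A * Bᵀ) ^ 2 ≤ τ ^ 4 * (Q * S) ^ 2 :=
    (pow_le_pow_left₀ (frobNorm_nonneg _) hXF 2).trans_eq (by ring)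
  have hYt : euclNorm (Y.col t) ≤ 2 * τ * Q * h := by
    refine le_of_sq_le_sq ?_ (by positivity)
    rw [hYcol]
    refine (euclNorm_add_sq_le _ _).trans ?_
    have h1 : euclNorm ((A * Bᵀ).col t) ^ 2 ≤ (τ * Q * h) ^ 2 :=
      pow_le_pow_left₀ (euclNorm_nonneg _)
        ((hgrid (B t)).trans (mul_le_mul_of_nonneg_left hB (by positivity))) 2
    have h2 : euclNorm (U.col t) ^ 2 ≤ (τ * Q * h) ^ 2 :=
      pow_le_pow_left₀ (euclNorm_nonneg _)
        ((htyp.noise_norm t).trans (le_mul_of_one_le_right (by positivity) hh)) 2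
    nlinarith
  have hW : ∀ t, euclNorm (Yᵀ *ᵥ U.col t) ≤ 2 * τ ^ 3 * (Q * S + Q ^ 2) := by
    intro t
    refine le_of_sq_le_sq ?_ (by positivity)
    rw [hY, Matrix.transpose_add, Matrix.add_mulVec]
    refine (euclNorm_add_sq_le _ _).trans ?_
    have h1 : euclNorm ((A * Bᵀ)ᵀ *ᵥ U.col t) ^ 2 ≤ τ ^ 2 * (τ ^ 4 * (Q * S) ^ 2) := by
      calc euclNorm ((A * Bᵀ)ᵀ *ᵥ U.col t) ^ 2
          ≤ ∑ r, τ ^ 2 * euclNorm ((A * Bᵀ)ᵀ r) ^ 2 := by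
            rw [euclNorm_sq]
            refine Finset.sum_le_sum fun r _ => ?_
            rw [← mul_pow, ← sq_abs]
            exact pow_le_pow_left₀ (abs_nonneg _) (htyp.col_signal r t) 2
        _ = τ ^ 2 * frobNorm (A * Bᵀ) ^ 2 := by
            rw [← Finset.mul_sum, ← frobNorm_sq_eq_sum, frobNorm_transpose]
        _ ≤ _ := by gcongr
    have hu : ∀ r, euclNorm (U.col r) ^ 2 ≤ (τ * Q) ^ 2 := fun r =>
      pow_le_pow_left₀ (euclNorm_nonneg _) (htyp.noise_norm r) 2
    have h2 : euclNorm (Uᵀ *ᵥ U.col t) ^ 2 ≤ (τ * Q) ^ 4 + S ^ 2 * (τ ^ 2 * (τ * Q) ^ 2) := by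
      calc euclNorm (Uᵀ *ᵥ U.col t) ^ 2 = ∑ r, (U.col r ⬝ᵥ U.col t) ^ 2 := euclNorm_sq _
        _ ≤ ∑ r, ((if r = t then (τ * Q) ^ 4 else 0) + τ ^ 2 * (τ * Q) ^ 2) := by
            refine Finset.sum_le_sum fun r _ => ?_
            split_ifs with hr
            · rw [hr, ← euclNorm_sq_eq_dotProduct]
              have := pow_le_pow_left₀ (sq_nonneg _) (hu t) 2
              nlinarith [show (0 : ℝ) ≤ τ ^ 2 * (τ * Q) ^ 2 by positivity]
            · rw [zero_add, ← sq_abs]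
              refine (pow_le_pow_left₀ (abs_nonneg _) (htyp.col_noise r t hr) 2).trans ?_
              rw [mul_pow]
              exact mul_le_mul_of_nonneg_left (hu r) (by positivity)
        _ = _ := by
            rw [Finset.sum_add_distrib]
            simp [hTS]
    have h3 : τ ^ 4 ≤ τ ^ 6 := pow_le_pow_right₀ hτ (by norm_num)
    have h4 : 0 ≤ Q * S := by positivity
    calc _ ≤ 2 * (τ ^ 6 * (Q * S) ^ 2) + 2 * (τ ^ 4 * ((Q ^ 2) ^ 2 + (Q * S) ^ 2)) := by
          refine (add_le_add (mul_le_mul_of_nonneg_left h1 zero_le_two)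
            (mul_le_mul_of_nonneg_left h2 zero_le_two)).trans_eq ?_
          ring
      _ ≤ 2 * (τ ^ 6 * (Q * S) ^ 2) + 2 * (τ ^ 6 * ((Q ^ 2) ^ 2 + (Q * S) ^ 2)) := by gcongr
      _ ≤ (2 * τ ^ 3 * (Q * S + Q ^ 2)) ^ 2 := by
          have : 0 ≤ τ ^ 6 * (Q ^ 2 * Q ^ 2 + 4 * (Q * S * Q ^ 2)) := by positivity
          nlinarith
  have hYU : euclNorm (Y *ᵥ U j) ≤ 3 * τ ^ 2 * (θ * (Q * S) + S ^ 2) := by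
    refine le_of_sq_le_sq ?_ (by positivity)
    rw [hY, Matrix.add_mulVec]
    refine (euclNorm_add_sq_le _ _).trans ?_
    have h1 : euclNorm ((A * Bᵀ) *ᵥ U j) ^ 2 ≤ θ ^ 2 * (τ ^ 4 * (Q * S) ^ 2) := by
      calc euclNorm ((A * Bᵀ) *ᵥ U j) ^ 2
          ≤ ∑ i, θ ^ 2 * euclNorm ((A * Bᵀ) i) ^ 2 := by
            rw [euclNorm_sq]
            refine Finset.sum_le_sum fun i _ => ?_
            rw [← mul_pow, ← sq_abs]
            exact pow_le_pow_left₀ (abs_nonneg _) (htyp.row_signal i j) 2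
        _ = θ ^ 2 * frobNorm (A * Bᵀ) ^ 2 := by
            rw [← Finset.mul_sum, ← frobNorm_sq_eq_sum]
        _ ≤ _ := by gcongr
    have h2 : euclNorm (U *ᵥ U j) ^ 2 ≤ 2 * (S ^ 4 * τ) + 2 * (Q ^ 2 * (S * θ) ^ 2) := by
      calc euclNorm (U *ᵥ U j) ^ 2 = ∑ i, (U i ⬝ᵥ U j) ^ 2 := euclNorm_sq _
        _ ≤ ∑ i, (2 * (S ^ 4 * Γ i j ^ 2) + 2 * (S * θ) ^ 2) := by
            refine Finset.sum_le_sum fun i _ => ?_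
            have h3 := htyp.row_noise i j
            rw [← hS, hTS] at h3
            have h4 := pow_le_pow_left₀ (abs_nonneg _) h3 2
            rw [sq_abs] at h4
            nlinarith [sq_nonneg (U i ⬝ᵥ U j - 2 * (S ^ 2 * Γ i j))]
        _ = 2 * (S ^ 4 * ∑ i, Γ i j ^ 2) + 2 * (Q ^ 2 * (S * θ) ^ 2) := by
            rw [Finset.sum_add_distrib, ← Finset.mul_sum, ← Finset.mul_sum]
            simp [hpQ]
            ring
        _ ≤ _ := by gcongr; exact hΓ j
    have h3 : τ ≤ τ ^ 4 := le_self_pow₀ hτ (by norm_num)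
    have h5 : 1 ≤ τ ^ 4 := one_le_pow₀ hτ
    calc _ ≤ 2 * (θ ^ 2 * (τ ^ 4 * (Q * S) ^ 2))
          + 2 * (2 * (S ^ 4 * τ) + 2 * (1 * (Q ^ 2 * (S * θ) ^ 2))) := by
          rw [one_mul]; gcongr
      _ ≤ 2 * (θ ^ 2 * (τ ^ 4 * (Q * S) ^ 2))
          + 2 * (2 * (S ^ 4 * τ ^ 4) + 2 * (τ ^ 4 * (Q ^ 2 * (S * θ) ^ 2))) := by gcongr
      _ ≤ (3 * τ ^ 2 * (θ * (Q * S) + S ^ 2)) ^ 2 := by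
          have : 0 ≤ τ ^ 4 * (3 * (θ * (Q * S)) ^ 2 + 5 * S ^ 4 + 18 * (θ * (Q * S) * S ^ 2)) := by
            positivity
          nlinarith
  have hmain := abs_estimation_error_le (d := τ / (T * p)) hY hE hc hcd (by positivity) heig
    (by positivity) hW j t
  simp only [Fintype.card_fin, ← hS] at hmain
  refine hmain.trans ?_
  have hsqrtL : √(L : ℝ) ≤ τ := by
    rw [Real.sqrt_le_left hτ0.le]
    exact hL.trans (le_self_pow₀ hτ two_ne_zero)
  have hsqrtLd : √(L : ℝ) * √(τ / (T * p)) ≤ τ / (S * Q) := by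
    rw [← Real.sqrt_mul (by positivity), Real.sqrt_le_left (by positivity), hTS, hpQ]
    rw [div_pow, ← mul_div_assoc, mul_pow]
    gcongr
    nlinarith
  rw [hTS, hpQ] at hsqrtLd ⊢
  exact scalar_error_le hS0 hQ0 hτ hθ hh hL (by positivity) hsqrtL (by positivity) hsqrtLd
    (euclNorm_nonneg _) hYt (euclNorm_nonneg _) hYU (frobNorm_nonneg _) htyp.scores
    (euclNorm_nonneg _) hB (hA j)

/-- The eigenvector equation for the Gram matrix in the form `E_k = c_k Yᵀ Y E_k`. -/
lemma IsLeadingEigenvectors.exists_inverse_eigenvalues {Y : Matrix (Fin p) (Fin T) ℝ}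
    {gam : ℕ → ℝ} {e : ℕ → Fin T → ℝ} (he : IsLeadingEigenvectors (gramMatrix Y) L gam e)
    {τ : ℝ} (hp : 0 < p) (hT : 0 < T)
    (hgam : (p : ℝ≥0∞) / ENNReal.ofReal (gam (L - 1)) ≤ ENNReal.ofReal τ) :
    (Matrix.of fun t (k : Fin L) => e k t)ᵀ * (Matrix.of fun t (k : Fin L) => e k t) = 1 ∧
    ∃ c : Fin L → ℝ, (∀ k, 0 ≤ c k) ∧ (∀ k, c k ≤ τ / (T * p)) ∧
      ∀ k, (Matrix.of fun t (k : Fin L) => e k t).col k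
        = c k • ((Yᵀ * Y) *ᵥ (Matrix.of fun t (k : Fin L) => e k t).col k) := by
  have hp' : (0 : ℝ) < p := by exact_mod_cast hp
  have hT' : (0 : ℝ) < T := by exact_mod_cast hT
  have hpos : 0 < gam (L - 1) := by
    by_contra h
    rw [ENNReal.ofReal_of_nonpos (not_lt.1 h), ENNReal.div_zero (by exact_mod_cast hp.ne')] at hgam
    exact ENNReal.ofReal_ne_top (top_le_iff.1 hgam)
  have hle : p / gam (L - 1) ≤ τ := by
    have h1 : (p : ℝ≥0∞) = ENNReal.ofReal p := (ENNReal.ofReal_natCast p).symm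
    rw [h1, ← ENNReal.ofReal_div_of_pos hpos] at hgam
    by_contra h
    have h2 : 0 < (p : ℝ) / gam (L - 1) := by positivity
    exact h ((ENNReal.ofReal_le_ofReal_iff' ).1 hgam |>.resolve_right (not_le.2 h2))
  have hmono : ∀ k : Fin L, gam (L - 1) ≤ gam k := by
    intro k
    have hk := k.2
    rcases eq_or_ne (k : ℕ) (L - 1) with h | h
    · rw [h]
    · refine he.leading k hk _ (e (L - 1)) (he.eigen _ (by omega)) ?_ fun l hl => ?_
      · intro h0
        have := he.orthonormal (L - 1) (by omega) (L - 1) (by omega)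
        simp [h0] at this
      · rw [he.orthonormal l (by omega) (L - 1) (by omega), if_neg (by omega)]
  refine ⟨?_, fun k => (gam k)⁻¹ * (T : ℝ)⁻¹, fun k => ?_, fun k => ?_, fun k => ?_⟩
  · ext k l
    have := he.orthonormal k k.2 l l.2
    rw [Matrix.one_apply]
    simp only [Fin.ext_iff]
    exact this
  · have := hpos.trans_le (hmono k)
    positivity
  · have h1 : (gam k)⁻¹ ≤ (gam (L - 1))⁻¹ := by
      gcongr
      exact hmono k
    calc (gam k)⁻¹ * (T : ℝ)⁻¹ ≤ (gam (L - 1))⁻¹ * (T : ℝ)⁻¹ := by gcongr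
      _ = (p / gam (L - 1)) / (T * p) := by field_simp
      _ ≤ τ / (T * p) := by gcongr
  · have h1 := he.eigen k k.2
    have h2 : gam k ≠ 0 := (hpos.trans_le (hmono k)).ne'
    rw [gramMatrix, Matrix.smul_mulVec] at h1
    have h3 : (Matrix.of fun t (k : Fin L) => e k t).col k = e k := rfl
    rw [h3, mul_smul, h1, smul_smul, inv_mul_cancel₀ h2, one_smul]

end Rates

/-! ### Tail bounds for Gaussian linear and quadratic forms -/

section Tails

variable {Ω : Type*} [MeasurableSpace Ω] {P : Measure Ω}

lemma ofReal_measureReal_le [IsFiniteMeasure P] {s : Set Ω} {r : ℝ} (h : P.real s ≤ r) :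
    P s ≤ ENNReal.ofReal r := by
  rw [← ofReal_measureReal (measure_ne_top P s)]
  exact ENNReal.ofReal_le_ofReal h

/-- Conditioning on one of two independent variables: a bound that holds with the first variable
frozen at every value holds for the pair. -/
lemma measure_pair_mem_le_of_indepFun [IsProbabilityMeasure P] {α β : Type*} [MeasurableSpace α]
    [MeasurableSpace β] {Z : Ω → α} {W : Ω → β} (hZ : Measurable Z) (hW : Measurable W)
    (hind : IndepFun Z W P) {F : Set (α × β)} (hF : MeasurableSet F) {δ : ℝ≥0∞}
    (h : ∀ z, P {ω | (z, W ω) ∈ F} ≤ δ) : P {ω | (Z ω, W ω) ∈ F} ≤ δ := by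
  have h1 : P {ω | (Z ω, W ω) ∈ F} = (P.map fun ω => (Z ω, W ω)) F :=
    (Measure.map_apply (hZ.prodMk hW) hF).symm
  rw [h1, (indepFun_iff_map_prod_eq_prod_map_map hZ.aemeasurable hW.aemeasurable).1 hind,
    Measure.prod_apply hF]
  have : IsProbabilityMeasure (P.map Z) := Measure.isProbabilityMeasure_map hZ.aemeasurable
  calc ∫⁻ z, (P.map W) (Prod.mk z ⁻¹' F) ∂(P.map Z) ≤ ∫⁻ _, δ ∂(P.map Z) := by
        refine lintegral_mono fun z => ?_
        rw [Measure.map_apply hW (measurable_prodMk_left hF)]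
        exact h z
    _ = δ := by simp

lemma measurable_euclNorm {n : Type*} [Fintype n] : Measurable (euclNorm : (n → ℝ) → ℝ) := by
  unfold euclNorm
  fun_prop

/-- A sub-Gaussian vector has small inner product with an independent vector. -/
lemma measure_mul_euclNorm_lt_abs_dotProduct_le [IsProbabilityMeasure P] {n : Type*} [Fintype n]
    {Z W : Ω → n → ℝ} (hZ : Measurable Z) (hW : Measurable W) (hind : IndepFun Z W P) {c : ℝ≥0}
    (hc : 0 < c)
    (hsub : ∀ x, HasSubgaussianMGF (fun ω => x ⬝ᵥ W ω) (c * (euclNorm x ^ 2).toNNReal) P)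
    {a : ℝ} (ha : 0 ≤ a) :
    P {ω | a * euclNorm (Z ω) < |Z ω ⬝ᵥ W ω|} ≤
      ENNReal.ofReal (2 * Real.exp (-a ^ 2 / (2 * c))) := by
  have hm : Measurable fun q : (n → ℝ) × (n → ℝ) => q.1 ⬝ᵥ q.2 := by
    unfold dotProduct
    fun_prop
  have hF : MeasurableSet {q : (n → ℝ) × (n → ℝ) | a * euclNorm q.1 < |q.1 ⬝ᵥ q.2|} :=
    measurableSet_lt ((measurable_euclNorm.comp measurable_fst).const_mul a)
      (by simpa using hm.norm)
  refine measure_pair_mem_le_of_indepFun hZ hW hind hF fun z => ?_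
  rcases eq_or_ne (euclNorm z) 0 with hz | hz
  · have h0 : {ω | (z, W ω) ∈ {q : (n → ℝ) × (n → ℝ) | a * euclNorm q.1 < |q.1 ⬝ᵥ q.2|}} = ∅ := by
      refine Set.eq_empty_of_forall_notMem fun ω hω => ?_
      have h1 : a * euclNorm z < |z ⬝ᵥ W ω| := hω
      have h2 := abs_dotProduct_le z (W ω)
      rw [hz] at h1 h2
      linarith
    rw [h0, measure_empty]
    exact zero_le
  · have hz0 : 0 < euclNorm z := lt_of_le_of_ne (euclNorm_nonneg _) hz.symm
    have hε : 0 ≤ a * euclNorm z := mul_nonneg ha hz0.le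
    have h1 := (hsub z).measure_ge_le hε
    have h2 := (hsub z).neg.measure_ge_le hε
    have hexp : -(a * euclNorm z) ^ 2 / (2 * ((c * (euclNorm z ^ 2).toNNReal : ℝ≥0) : ℝ))
        = -a ^ 2 / (2 * c) := by
      rw [NNReal.coe_mul, Real.coe_toNNReal _ (sq_nonneg _)]
      have : (0 : ℝ) < c := hc
      field_simp
    rw [hexp] at h1 h2
    refine ofReal_measureReal_le ?_
    calc _ ≤ P.real ({ω | a * euclNorm z ≤ z ⬝ᵥ W ω}
          ∪ {ω | a * euclNorm z ≤ (-fun ω => z ⬝ᵥ W ω) ω}) := by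
          refine measureReal_mono (fun ω hω => ?_) (measure_ne_top _ _)
          have h3 : a * euclNorm z < |z ⬝ᵥ W ω| := hω
          rcases lt_abs.1 h3 with h | h
          · exact Or.inl h.le
          · exact Or.inr h.le
      _ ≤ _ := (measureReal_union_le _ _).trans (by linarith)

lemma integral_exp_mul_sq_gaussianReal {v : ℝ≥0} {θ : ℝ} (h : θ * v < 1 / 2) :
    ∫ w, Real.exp (θ * w ^ 2) ∂(gaussianReal 0 v) = (√(1 - 2 * (θ * v)))⁻¹ := by
  rcases eq_or_ne v 0 with rfl | hv
  · simp
  · have hv0 : (0 : ℝ) < v := by positivity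
    rw [integral_gaussianReal_eq_integral_smul hv]
    have h1 : ∀ w : ℝ, gaussianPDFReal 0 v w • Real.exp (θ * w ^ 2)
        = (√(2 * Real.pi * v))⁻¹ * Real.exp (-(1 / (2 * v) - θ) * w ^ 2) := by
      intro w
      rw [gaussianPDFReal, smul_eq_mul, mul_assoc, ← Real.exp_add]
      congr 2
      field_simp
      ring
    simp_rw [h1]
    rw [integral_const_mul, integral_gaussian]
    have h2 : 0 < 1 - 2 * (θ * v) := by linarith
    rw [← Real.sqrt_inv, ← Real.sqrt_inv, ← Real.sqrt_mul (by positivity)]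
    congr 1
    have h3 : 1 / (2 * (v : ℝ)) - θ = (1 - 2 * (θ * v)) / (2 * v) := by field_simp
    rw [h3]
    have := Real.pi_pos
    field_simp

lemma inv_sqrt_one_sub_le_exp {x : ℝ} (h : |x| ≤ 1 / 4) :
    (√(1 - 2 * x))⁻¹ ≤ Real.exp (x + 2 * x ^ 2) := by
  obtain ⟨h1, h2⟩ := abs_le.1 h
  have hpos : 0 < 1 - 2 * x := by linarith
  have key : 1 ≤ Real.exp (2 * x + 4 * x ^ 2) * (1 - 2 * x) := by
    rcases le_total 0 x with hx | hx
    · have h3 := Real.quadratic_le_exp_of_nonneg (show 0 ≤ 2 * x + 4 * x ^ 2 by positivity)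
      have h4 : 1 ≤ (1 + (2 * x + 4 * x ^ 2) + (2 * x + 4 * x ^ 2) ^ 2 / 2) * (1 - 2 * x) := by
        have h5 : 0 ≤ 1 - 2 * x - 4 * x ^ 2 - 8 * x ^ 3 := by
          nlinarith [mul_nonneg hx (sub_nonneg.2 h2), mul_nonneg (sq_nonneg x) (sub_nonneg.2 h2)]
        nlinarith [mul_nonneg (sq_nonneg x) h5]
      exact h4.trans (mul_le_mul_of_nonneg_right h3 hpos.le)
    · have h3 := Real.add_one_le_exp (2 * x + 4 * x ^ 2)
      have h4 : 1 ≤ (2 * x + 4 * x ^ 2 + 1) * (1 - 2 * x) := by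
        nlinarith [mul_nonneg (sq_nonneg x) (neg_nonneg.2 hx)]
      exact h4.trans (mul_le_mul_of_nonneg_right h3 hpos.le)
  rw [inv_le_comm₀ (Real.sqrt_pos.2 hpos) (Real.exp_pos _), ← Real.exp_neg]
  refine Real.le_sqrt_of_sq_le ?_
  rw [← Real.exp_nat_mul]
  have h6 : ((2 : ℕ) : ℝ) * -(x + 2 * x ^ 2) = -(2 * x + 4 * x ^ 2) := by push_cast; ring
  rw [h6, Real.exp_neg, inv_le_iff_one_le_mul₀ (Real.exp_pos _), mul_comm]
  exact key

lemma integrable_exp_mul_sq_of_gaussian {w : Ω → ℝ} {v : ℝ≥0} (hw : AEMeasurable w P)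
    (hlaw : P.map w = gaussianReal 0 v) {θ : ℝ} (h : θ * v < 1 / 2) :
    Integrable (fun ω => Real.exp (θ * w ω ^ 2)) P := by
  have h1 : Integrable (fun x => Real.exp (θ * x ^ 2)) (gaussianReal 0 v) := by
    refine Integrable.of_integral_ne_zero ?_
    rw [integral_exp_mul_sq_gaussianReal h]
    have : 0 < 1 - 2 * (θ * v) := by linarith
    positivity
  rw [← hlaw] at h1
  exact h1.comp_aemeasurable hw

lemma integral_exp_mul_sq_of_gaussian {w : Ω → ℝ} {v : ℝ≥0} (hw : AEMeasurable w P)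
    (hlaw : P.map w = gaussianReal 0 v) {θ : ℝ} (h : θ * v < 1 / 2) :
    ∫ ω, Real.exp (θ * w ω ^ 2) ∂P = (√(1 - 2 * (θ * v)))⁻¹ := by
  rw [← integral_exp_mul_sq_gaussianReal h, ← hlaw, integral_map hw]
  exact (by fun_prop : Continuous fun x : ℝ => Real.exp (θ * x ^ 2)).aestronglyMeasurable

lemma mgf_sq_sub_variance_le {w : Ω → ℝ} {v : ℝ≥0} (hw : AEMeasurable w P)
    (hlaw : P.map w = gaussianReal 0 v) {θ : ℝ} (h : |θ * v| ≤ 1 / 4) :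
    mgf (fun ω => w ω ^ 2 - v) P θ ≤ Real.exp (2 * (θ * v) ^ 2) := by
  have h1 : ∀ ω, Real.exp (θ * (w ω ^ 2 - v)) = Real.exp (-(θ * v)) * Real.exp (θ * w ω ^ 2) := by
    intro ω
    rw [← Real.exp_add]
    ring_nf
  have h2 : θ * v < 1 / 2 := (le_abs_self _).trans_lt (by linarith)
  unfold mgf
  simp_rw [h1]
  rw [integral_const_mul, integral_exp_mul_sq_of_gaussian hw hlaw h2]
  calc _ ≤ Real.exp (-(θ * v)) * Real.exp (θ * v + 2 * (θ * v) ^ 2) := by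
        gcongr
        exact inv_sqrt_one_sub_le_exp h
    _ = _ := by
        rw [← Real.exp_add]
        ring_nf

lemma measureReal_sum_sq_ge_le [IsProbabilityMeasure P] {ι : Type*} [Fintype ι] {w : ι → Ω → ℝ}
    {v : ℝ≥0} (hw : ∀ i, Measurable (w i)) (hind : iIndepFun w P)
    (hlaw : ∀ i, P.map (w i) = gaussianReal 0 v) {V a s : ℝ} (hs : s ^ 2 = 1) (hv : v ≤ V)
    (hV : 1 ≤ V) (ha : 0 ≤ a) (haT : a ≤ √(Fintype.card ι)) :
    P.real {ω | √(Fintype.card ι) * a ≤ s * ∑ i, (w i ω ^ 2 - v)} ≤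
      Real.exp (-a ^ 2 / (8 * V ^ 2)) := by
  rcases isEmpty_or_nonempty ι with hι | hι
  · have ha0 : a = 0 := le_antisymm (by simpa using haT) ha
    simp [ha0]
  set S := √(Fintype.card ι : ℝ) with hS
  have hS0 : 0 < S := Real.sqrt_pos.2 (by exact_mod_cast Fintype.card_pos)
  have hSS : (Fintype.card ι : ℝ) = S ^ 2 := (Real.sq_sqrt (by positivity)).symm
  have hV0 : 0 < V := by linarith
  -- the optimal parameter of the exponential Markov inequality, up to constants
  set θ := a / (4 * V ^ 2 * S) with hθ
  have hθ0 : 0 ≤ θ := by positivity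
  have hθs : |s * θ| = θ := by
    rw [abs_mul, abs_of_nonneg hθ0,
      (pow_eq_one_iff_of_nonneg (abs_nonneg s) two_ne_zero).1 (by rw [sq_abs, hs]), one_mul]
  have hv0 : (0 : ℝ) ≤ v := v.2
  have hθV : θ * V ≤ 1 / 4 := by
    have : θ * V = (a / S) / V / 4 := by rw [hθ]; field_simp
    rw [this]
    have h1 : a / S ≤ 1 := (div_le_one hS0).2 haT
    have h2 : a / S / V ≤ 1 := (div_le_one hV0).2 (h1.trans hV)
    linarith
  have hθv : |s * θ * v| ≤ 1 / 4 := by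
    rw [abs_mul, hθs, abs_of_nonneg hv0]
    exact (mul_le_mul_of_nonneg_left hv hθ0).trans hθV
  set ζ : ι → Ω → ℝ := fun i ω => w i ω ^ 2 - v with hζ
  have hζm : ∀ i, Measurable (ζ i) := fun i => ((hw i).pow_const 2).sub_const _
  have hζind : iIndepFun ζ P :=
    hind.comp (fun _ x => x ^ 2 - (v : ℝ)) fun _ => by fun_prop
  have hint : ∀ i ∈ Finset.univ, Integrable (fun ω => Real.exp (s * θ * ζ i ω)) P := by
    intro i _
    have h1 := (integrable_exp_mul_sq_of_gaussian (hw i).aemeasurable (hlaw i)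
      (θ := s * θ) ((le_abs_self _).trans_lt (by linarith))).const_mul (Real.exp (-(s * θ * v)))
    refine h1.congr (Eventually.of_forall fun ω => ?_)
    simp only [hζ]
    rw [← Real.exp_add]
    ring_nf
  have hint' := hζind.integrable_exp_mul_sum hζm hint
  have hmgf : mgf (∑ i, ζ i) P (s * θ) ≤ Real.exp (S ^ 2 * (2 * (θ * V) ^ 2)) := by
    rw [hζind.mgf_sum hζm]
    calc ∏ i, mgf (ζ i) P (s * θ) ≤ ∏ _i : ι, Real.exp (2 * (θ * V) ^ 2) := by
          refine Finset.prod_le_prod (fun i _ => mgf_nonneg) fun i _ => ?_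
          refine (mgf_sq_sub_variance_le (hw i).aemeasurable (hlaw i) hθv).trans ?_
          rw [Real.exp_le_exp]
          have : (s * θ * v) ^ 2 = (θ * v) ^ 2 := by rw [mul_assoc, mul_pow, hs, one_mul]
          rw [this]
          gcongr
      _ = _ := by
          rw [Finset.prod_const, Finset.card_univ, ← Real.exp_nat_mul, hSS]
  have hch := measure_ge_le_exp_mul_mgf (X := fun ω => s * ∑ i, ζ i ω) (μ := P) (t := θ)
    (S * a) hθ0 (by
      refine hint'.congr (Eventually.of_forall fun ω => ?_)
      simp only [Finset.sum_apply]
      ring_nf)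
  have hmgf' : mgf (fun ω => s * ∑ i, ζ i ω) P θ = mgf (∑ i, ζ i) P (s * θ) := by
    unfold mgf
    congr 1
    ext ω
    simp only [Finset.sum_apply]
    ring_nf
  rw [hmgf'] at hch
  refine hch.trans ((mul_le_mul_of_nonneg_left hmgf (Real.exp_pos _).le).trans ?_)
  rw [← Real.exp_add, Real.exp_le_exp]
  have h1 : -θ * (S * a) + S ^ 2 * (2 * (θ * V) ^ 2) = -a ^ 2 / (8 * V ^ 2) := by
    rw [hθ]
    field_simp
    ring
  exact h1.le

/-- Bernstein's inequality for sums of centred squares of independent Gaussian variables. -/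
lemma measure_abs_sum_sq_sub_gt_le [IsProbabilityMeasure P] {ι : Type*} [Fintype ι]
    {w : ι → Ω → ℝ} {v : ℝ≥0} (hw : ∀ i, Measurable (w i)) (hind : iIndepFun w P)
    (hlaw : ∀ i, P.map (w i) = gaussianReal 0 v) {V a : ℝ} (hv : v ≤ V)
    (hV : 1 ≤ V) (ha : 0 ≤ a) (haT : a ≤ √(Fintype.card ι)) :
    P {ω | √(Fintype.card ι) * a < |∑ i, (w i ω ^ 2 - v)|} ≤
      ENNReal.ofReal (2 * Real.exp (-a ^ 2 / (8 * V ^ 2))) := by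
  refine ofReal_measureReal_le ?_
  have h1 := measureReal_sum_sq_ge_le hw hind hlaw (s := 1) (by norm_num) hv hV ha haT
  have h2 := measureReal_sum_sq_ge_le hw hind hlaw (s := -1) (by norm_num) hv hV ha haT
  calc _ ≤ P.real ({ω | √(Fintype.card ι) * a ≤ 1 * ∑ i, (w i ω ^ 2 - v)}
        ∪ {ω | √(Fintype.card ι) * a ≤ -1 * ∑ i, (w i ω ^ 2 - v)}) := by
        refine measureReal_mono (fun ω hω => ?_) (measure_ne_top _ _)
        rcases lt_abs.1 (show √(Fintype.card ι) * a < |∑ i, (w i ω ^ 2 - v)| from hω) with h | h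
        · left
          rw [Set.mem_ofPred_eq, one_mul]
          exact h.le
        · right
          rw [Set.mem_ofPred_eq, neg_one_mul]
          exact h.le
    _ ≤ _ := (measureReal_union_le _ _).trans (by linarith)

end Tails

/-! ### Gaussian noise with summable autocovariances -/

section Noise

variable {Ω : Type*} [MeasurableSpace Ω] {P : Measure Ω}

/-- Independent centred Gaussian vectors whose coordinates have a stationary covariance with
absolutely summable autocovariances. -/
structure IsGaussianNoise (P : Measure Ω) {p : ℕ} (u : ℕ → Ω → Fin p → ℝ) (γ : ℤ → ℝ)
    (C : ℝ≥0) : Prop where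
  measurable : ∀ t, Measurable (u t)
  indep : iIndepFun u P
  gaussian : ∀ t, HasGaussianLaw (u t) P
  mean_zero : ∀ t i, ∫ ω, u t ω i ∂P = 0
  summable : Summable fun h => |γ h|
  tsum_le : ∑' h, |γ h| ≤ C
  covariance : ∀ t (i j : Fin p), cov[fun ω => u t ω i, fun ω => u t ω j; P] = γ ((i : ℤ) - j)

variable {p : ℕ} {u : ℕ → Ω → Fin p → ℝ} {γ : ℤ → ℝ} {C : ℝ≥0}

namespace IsGaussianNoise

lemma sum_abs_le (hu : IsGaussianNoise P u γ C) (j : Fin p) :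
    ∑ i : Fin p, |γ ((i : ℤ) - j)| ≤ C := by
  have hinj : Function.Injective fun i : Fin p => (i : ℤ) - j := by
    intro a b h
    ext
    simpa using h
  have h := hu.summable.sum_le_tsum (Finset.univ.map ⟨fun i : Fin p => (i : ℤ) - j, hinj⟩)
    fun _ _ => abs_nonneg _
  rw [Finset.sum_map] at h
  exact h.trans hu.tsum_le

lemma abs_autocov_le (hu : IsGaussianNoise P u γ C) (h : ℤ) : |γ h| ≤ C := by
  have := hu.summable.sum_le_tsum {h} fun _ _ => abs_nonneg _
  rw [Finset.sum_singleton] at this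
  exact this.trans hu.tsum_le

lemma sum_sq_le (hu : IsGaussianNoise P u γ C) (j : Fin p) :
    ∑ i : Fin p, γ ((i : ℤ) - j) ^ 2 ≤ C ^ 2 := by
  calc ∑ i : Fin p, γ ((i : ℤ) - j) ^ 2 ≤ ∑ i : Fin p, C * |γ ((i : ℤ) - j)| := by
        refine Finset.sum_le_sum fun i _ => ?_
        rw [← sq_abs, sq]
        exact mul_le_mul_of_nonneg_right (hu.abs_autocov_le _) (abs_nonneg _)
    _ ≤ C ^ 2 := by
        rw [← Finset.mul_sum, sq]
        exact mul_le_mul_of_nonneg_left (hu.sum_abs_le j) C.2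

lemma cov_symm (hu : IsGaussianNoise P u γ C) (i j : Fin p) :
    γ ((i : ℤ) - j) = γ ((j : ℤ) - i) := by
  rw [← hu.covariance 0 i j, ← hu.covariance 0 j i, covariance_comm]

lemma memLp_two (hu : IsGaussianNoise P u γ C) (t : ℕ) (i : Fin p) :
    MemLp (fun ω => u t ω i) 2 P :=
  ((hu.gaussian t).eval i).memLp_two

lemma measurable_coord (hu : IsGaussianNoise P u γ C) (t : ℕ) (i : Fin p) :
    Measurable fun ω => u t ω i :=
  (measurable_pi_apply i).comp (hu.measurable t)

lemma hasGaussianLaw_dotProduct (hu : IsGaussianNoise P u γ C) (t : ℕ) (x : Fin p → ℝ) :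
    HasGaussianLaw (fun ω => x ⬝ᵥ u t ω) P := by
  have h := (hu.gaussian t).map_fun (∑ i, x i • ContinuousLinearMap.proj (R := ℝ) i)
  refine h.congr (Eventually.of_forall fun ω => ?_)
  simp [dotProduct]

lemma indep_coord (hu : IsGaussianNoise P u γ C) (T : ℕ) (j : Fin p) :
    iIndepFun (fun (t : Fin T) ω => u t ω j) P :=
  (hu.indep.precomp Fin.val_injective).comp (fun _ x => x j) fun _ => measurable_pi_apply j

variable [IsProbabilityMeasure P]

lemma integral_dotProduct (hu : IsGaussianNoise P u γ C) (t : ℕ) (x : Fin p → ℝ) :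
    ∫ ω, x ⬝ᵥ u t ω ∂P = 0 := by
  unfold dotProduct
  rw [integral_finsetSum _ fun i _ => ((hu.memLp_two t i).integrable one_le_two).const_mul _]
  refine Finset.sum_eq_zero fun i _ => ?_
  rw [integral_const_mul, hu.mean_zero, mul_zero]

lemma variance_dotProduct (hu : IsGaussianNoise P u γ C) (t : ℕ) (x : Fin p → ℝ) :
    Var[fun ω => x ⬝ᵥ u t ω; P] = ∑ i, ∑ j, x i * x j * γ ((i : ℤ) - j) := by
  rw [← covariance_self (hu.hasGaussianLaw_dotProduct t x).aemeasurable]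
  unfold dotProduct
  rw [covariance_fun_sum_fun_sum (fun i => (hu.memLp_two t i).const_mul _)
    (fun i => (hu.memLp_two t i).const_mul _)]
  refine Finset.sum_congr rfl fun i _ => Finset.sum_congr rfl fun j _ => ?_
  rw [covariance_const_mul_left, covariance_const_mul_right, hu.covariance]
  ring

/-- Schur's test for the Toeplitz covariance matrix. -/
lemma variance_dotProduct_le (hu : IsGaussianNoise P u γ C) (t : ℕ) (x : Fin p → ℝ) :
    Var[fun ω => x ⬝ᵥ u t ω; P] ≤ C * euclNorm x ^ 2 := by
  rw [hu.variance_dotProduct]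
  have h1 : ∀ i j : Fin p, x i * x j * γ ((i : ℤ) - j)
      ≤ x i ^ 2 / 2 * |γ ((j : ℤ) - i)| + x j ^ 2 / 2 * |γ ((i : ℤ) - j)| := by
    intro i j
    rw [hu.cov_symm j i, ← add_mul]
    refine (le_abs_self _).trans ?_
    rw [abs_mul]
    refine mul_le_mul_of_nonneg_right ?_ (abs_nonneg _)
    rw [abs_mul, ← sq_abs (x i), ← sq_abs (x j)]
    nlinarith [sq_nonneg (|x i| - |x j|)]
  have h2 : ∀ i : Fin p, ∑ j : Fin p, x i ^ 2 / 2 * |γ ((j : ℤ) - i)| ≤ x i ^ 2 / 2 * C := by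
    intro i
    rw [← Finset.mul_sum]
    exact mul_le_mul_of_nonneg_left (hu.sum_abs_le i) (by positivity)
  calc _ ≤ ∑ i : Fin p, ∑ j : Fin p,
          (x i ^ 2 / 2 * |γ ((j : ℤ) - i)| + x j ^ 2 / 2 * |γ ((i : ℤ) - j)|) :=
        Finset.sum_le_sum fun i _ => Finset.sum_le_sum fun j _ => h1 i j
    _ = (∑ i : Fin p, ∑ j : Fin p, x i ^ 2 / 2 * |γ ((j : ℤ) - i)|)
          + ∑ j : Fin p, ∑ i : Fin p, x j ^ 2 / 2 * |γ ((i : ℤ) - j)| := by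
        simp_rw [Finset.sum_add_distrib]
        congr 1
        exact Finset.sum_comm
    _ ≤ (∑ i : Fin p, x i ^ 2 / 2 * C) + ∑ j : Fin p, x j ^ 2 / 2 * C :=
        add_le_add (Finset.sum_le_sum fun i _ => h2 i) (Finset.sum_le_sum fun i _ => h2 i)
    _ = _ := by
        rw [euclNorm_sq, ← Finset.sum_add_distrib, Finset.mul_sum]
        refine Finset.sum_congr rfl fun i _ => ?_
        ring

lemma hasSubgaussianMGF_dotProduct (hu : IsGaussianNoise P u γ C) (t : ℕ) (x : Fin p → ℝ) :
    HasSubgaussianMGF (fun ω => x ⬝ᵥ u t ω) (C * (euclNorm x ^ 2).toNNReal) P := by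
  have hlaw := (hu.hasGaussianLaw_dotProduct t x).map_eq_gaussianReal
  rw [hu.integral_dotProduct] at hlaw
  have hm := (hu.hasGaussianLaw_dotProduct t x).aemeasurable
  refine ⟨fun r => ?_, fun r => ?_⟩
  · have h := integrable_exp_mul_gaussianReal (μ := 0)
      (v := Var[fun ω => x ⬝ᵥ u t ω; P].toNNReal) r
    rw [← hlaw] at h
    exact h.comp_aemeasurable hm
  · rw [mgf_gaussianReal hlaw, Real.exp_le_exp, zero_mul, zero_add, NNReal.coe_mul,
      Real.coe_toNNReal _ (variance_nonneg _ _), Real.coe_toNNReal _ (sq_nonneg _)]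
    gcongr
    exact hu.variance_dotProduct_le t x

lemma hasSubgaussianMGF_coord (hu : IsGaussianNoise P u γ C) (t : ℕ) (j : Fin p) :
    HasSubgaussianMGF (fun ω => u t ω j) C P := by
  have h := hu.hasSubgaussianMGF_dotProduct t (Pi.single j 1)
  have h1 : euclNorm (Pi.single j 1 : Fin p → ℝ) ^ 2 = 1 := by
    rw [euclNorm_sq_eq_dotProduct]
    simp
  simpa [h1] using h

lemma hasSubgaussianMGF_row (hu : IsGaussianNoise P u γ C) {T : ℕ} (j : Fin p) (x : Fin T → ℝ) :
    HasSubgaussianMGF (fun ω => x ⬝ᵥ fun t => u t ω j) (C * (euclNorm x ^ 2).toNNReal) P := by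
  have h := HasSubgaussianMGF.sum_of_iIndepFun
    ((hu.indep_coord T j).comp (fun t y => x t * y) fun t => measurable_const_mul (x t))
    (s := Finset.univ) (c := fun t => C * (x t ^ 2).toNNReal) fun t _ => by
      have h1 := (hu.hasSubgaussianMGF_coord t j).const_mul (x t)
      have h2 : C * (x t ^ 2).toNNReal = ⟨x t ^ 2, sq_nonneg _⟩ * C := by
        rw [mul_comm]
        congr 1
        ext
        rw [Real.coe_toNNReal _ (sq_nonneg _)]
        rfl
      rw [h2]
      exact h1
  have h3 : C * (euclNorm x ^ 2).toNNReal = ∑ t, C * (x t ^ 2).toNNReal := by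
    rw [← Finset.mul_sum, euclNorm_sq, Real.toNNReal_sum_of_nonneg fun _ _ => sq_nonneg _]
  rw [h3]
  exact h

/-- The products of two noise coordinates, summed over time, concentrate: by polarization they are
differences of sums of squares of independent Gaussian variables. -/
lemma measure_row_product_le (hu : IsGaussianNoise P u γ C) (hC : 1 ≤ C) (T : ℕ) (i j : Fin p)
    {a : ℝ} (ha : 0 ≤ a) (haT : a ≤ √T) :
    P {ω | √T * a < |((fun t : Fin T => u t ω i) ⬝ᵥ fun t : Fin T => u t ω j)
        - T * γ ((i : ℤ) - j)|} ≤
      ENNReal.ofReal (4 * Real.exp (-a ^ 2 / (128 * C ^ 2))) := by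
  have hvar_eq : ∀ s : ℝ, ∀ t : ℕ, Var[fun ω => u t ω i + s * u t ω j; P]
      = γ 0 + 2 * s * γ ((i : ℤ) - j) + s ^ 2 * γ 0 := by
    intro s t
    have hmi := hu.memLp_two t i
    have hmj := hu.memLp_two t j
    rw [variance_fun_add hmi (hmj.const_mul s), variance_const_mul, covariance_const_mul_right,
      hu.covariance, ← covariance_self hmi.aemeasurable, ← covariance_self hmj.aemeasurable,
      hu.covariance, hu.covariance, sub_self, sub_self]
    ring
  have hlaw : ∀ s : ℝ, ∀ t : Fin T, P.map (fun ω => u t ω i + s * u t ω j)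
      = gaussianReal 0 (γ 0 + 2 * s * γ ((i : ℤ) - j) + s ^ 2 * γ 0).toNNReal := by
    intro s t
    have hG : HasGaussianLaw (fun ω => u t ω i + s * u t ω j) P := by
      have h := (hu.gaussian t).map_fun (ContinuousLinearMap.proj (R := ℝ) i
        + s • ContinuousLinearMap.proj (R := ℝ) j)
      refine h.congr (Eventually.of_forall fun ω => ?_)
      simp
    rw [hG.map_eq_gaussianReal, hvar_eq]
    congr 1
    rw [integral_add ((hu.memLp_two t i).integrable one_le_two)
      (((hu.memLp_two t j).integrable one_le_two).const_mul _),
      integral_const_mul, hu.mean_zero, hu.mean_zero]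
    simp
  have hvar : ∀ s : ℝ, s ^ 2 = 1 → 0 ≤ γ 0 + 2 * s * γ ((i : ℤ) - j) + s ^ 2 * γ 0 ∧
      γ 0 + 2 * s * γ ((i : ℤ) - j) + s ^ 2 * γ 0 ≤ 4 * C := by
    intro s hs
    refine ⟨by rw [← hvar_eq s 0]; exact variance_nonneg _ _, ?_⟩
    have h0 := abs_le.1 (hu.abs_autocov_le 0)
    have hh := abs_le.1 (hu.abs_autocov_le ((i : ℤ) - j))
    rcases mul_self_eq_one_iff.1 (show s * s = 1 by rw [← sq, hs]) with rfl | rfl <;> linarith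
  have htail : ∀ s : ℝ, s ^ 2 = 1 → P {ω | √T * a < |∑ t : Fin T, ((u t ω i + s * u t ω j) ^ 2
      - (γ 0 + 2 * s * γ ((i : ℤ) - j) + s ^ 2 * γ 0))|} ≤
      ENNReal.ofReal (2 * Real.exp (-a ^ 2 / (128 * C ^ 2))) := by
    intro s hs
    have hind : iIndepFun (fun (t : Fin T) ω => u t ω i + s * u t ω j) P :=
      (hu.indep.precomp Fin.val_injective).comp (fun _ x => x i + s * x j) fun _ => by fun_prop
    have h := measure_abs_sum_sq_sub_gt_le (V := 4 * C) (a := a)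
      (w := fun (t : Fin T) ω => u t ω i + s * u t ω j)
      (fun t => (hu.measurable_coord t i).add ((hu.measurable_coord t j).const_mul s))
      hind (hlaw s) (by rw [Real.coe_toNNReal _ (hvar s hs).1]; exact (hvar s hs).2)
      (by have : (1 : ℝ) ≤ C := hC
          linarith) ha (by simpa using haT)
    simp only [Fintype.card_fin, Real.coe_toNNReal _ (hvar s hs).1] at h
    convert h using 4
    ring
  have hsub : {ω | √T * a < |((fun t : Fin T => u t ω i) ⬝ᵥ fun t : Fin T => u t ω j)
        - T * γ ((i : ℤ) - j)|} ⊆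
      {ω | √T * a < |∑ t : Fin T, ((u t ω i + 1 * u t ω j) ^ 2
        - (γ 0 + 2 * 1 * γ ((i : ℤ) - j) + 1 ^ 2 * γ 0))|} ∪
      {ω | √T * a < |∑ t : Fin T, ((u t ω i + (-1) * u t ω j) ^ 2
        - (γ 0 + 2 * (-1) * γ ((i : ℤ) - j) + (-1) ^ 2 * γ 0))|} := by
    intro ω hω
    by_contra hnot
    rw [Set.mem_union, not_or, Set.mem_ofPred_eq, Set.mem_ofPred_eq] at hnot
    have h1 := not_lt.1 hnot.1
    have h2 := not_lt.1 hnot.2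
    have hω' : √T * a < |((fun t : Fin T => u t ω i) ⬝ᵥ fun t : Fin T => u t ω j)
        - T * γ ((i : ℤ) - j)| := hω
    have hid : ((fun t : Fin T => u t ω i) ⬝ᵥ fun t : Fin T => u t ω j) - T * γ ((i : ℤ) - j)
        = (∑ t : Fin T, ((u t ω i + 1 * u t ω j) ^ 2
            - (γ 0 + 2 * 1 * γ ((i : ℤ) - j) + 1 ^ 2 * γ 0))
          - ∑ t : Fin T, ((u t ω i + (-1) * u t ω j) ^ 2
            - (γ 0 + 2 * (-1) * γ ((i : ℤ) - j) + (-1) ^ 2 * γ 0))) / 4 := by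
      have hT : (T : ℝ) * γ ((i : ℤ) - j) = ∑ _t : Fin T, γ ((i : ℤ) - j) := by simp
      rw [← Finset.sum_sub_distrib, Finset.sum_div, hT, dotProduct, ← Finset.sum_sub_distrib]
      refine Finset.sum_congr rfl fun t _ => ?_
      ring
    rw [hid, abs_div, abs_of_pos (show (0 : ℝ) < 4 by norm_num), lt_div_iff₀ (by norm_num)] at hω'
    have h3 := abs_sub (∑ t : Fin T, ((u t ω i + 1 * u t ω j) ^ 2
            - (γ 0 + 2 * 1 * γ ((i : ℤ) - j) + 1 ^ 2 * γ 0)))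
          (∑ t : Fin T, ((u t ω i + (-1) * u t ω j) ^ 2
            - (γ 0 + 2 * (-1) * γ ((i : ℤ) - j) + (-1) ^ 2 * γ 0)))
    have h4 : 0 ≤ √(T : ℝ) * a := by positivity
    linarith
  refine (measure_mono hsub).trans ((measure_union_le _ _).trans ?_)
  refine (add_le_add (htail 1 (by norm_num)) (htail (-1) (by norm_num))).trans ?_
  rw [← ENNReal.ofReal_add (by positivity) (by positivity)]
  exact ENNReal.ofReal_le_ofReal (by linarith)

/-- By convexity of the exponential, an exponential moment of the mean square of the coordinates of
a noise vector is at most that of a single squared coordinate. -/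
lemma measure_euclNorm_gt_le (hu : IsGaussianNoise P u γ C) (hC : 1 ≤ C) (hp : 0 < p) (t : ℕ)
    {a : ℝ} (ha : 0 ≤ a) :
    P {ω | a * √p < euclNorm (u t ω)} ≤ ENNReal.ofReal (2 * Real.exp (-a ^ 2 / (4 * C))) := by
  have hC0 : (0 : ℝ) < C := lt_of_lt_of_le one_pos hC
  have hp0 : (0 : ℝ) < p := by exact_mod_cast hp
  set θ : ℝ := 1 / (4 * C) with hθ
  have hlaw : ∀ i, P.map (fun ω => u t ω i) = gaussianReal 0 (γ 0).toNNReal := by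
    intro i
    rw [((hu.gaussian t).eval i).map_eq_gaussianReal, hu.mean_zero,
      ← covariance_self (hu.memLp_two t i).aemeasurable, hu.covariance, sub_self]
  have hθv : θ * (γ 0).toNNReal ≤ 1 / 4 := by
    have h1 : ((γ 0).toNNReal : ℝ) ≤ C := by
      rw [Real.coe_toNNReal']
      exact max_le ((le_abs_self _).trans (hu.abs_autocov_le 0)) C.2
    rw [hθ, div_mul_eq_mul_div, one_mul, div_le_div_iff₀ (by positivity) (by norm_num)]
    linarith
  have hint : ∀ i, Integrable (fun ω => Real.exp (θ * u t ω i ^ 2)) P := fun i =>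
    integrable_exp_mul_sq_of_gaussian (hu.measurable_coord t i).aemeasurable (hlaw i) (by linarith)
  have hle : ∀ i, ∫ ω, Real.exp (θ * u t ω i ^ 2) ∂P ≤ 2 := by
    intro i
    rw [integral_exp_mul_sq_of_gaussian (hu.measurable_coord t i).aemeasurable (hlaw i)
      (by linarith)]
    refine inv_le_of_inv_le₀ (by norm_num) (Real.le_sqrt_of_sq_le ?_)
    rw [inv_pow]
    linarith
  have hconv : ∀ ω, Real.exp (θ / p * euclNorm (u t ω) ^ 2)
      ≤ (p : ℝ)⁻¹ * ∑ i, Real.exp (θ * u t ω i ^ 2) := by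
    intro ω
    have h := convexOn_exp.map_sum_le (t := Finset.univ) (w := fun _ : Fin p => (p : ℝ)⁻¹)
      (p := fun i => θ * u t ω i ^ 2) (fun _ _ => by positivity) (by simp [hp0.ne'])
      (fun _ _ => Set.mem_univ _)
    simp only [smul_eq_mul] at h
    rw [← Finset.mul_sum, ← Finset.mul_sum, ← Finset.mul_sum, ← euclNorm_sq] at h
    refine (le_of_eq ?_).trans h
    congr 1
    ring
  have hsum : Integrable (fun ω => (p : ℝ)⁻¹ * ∑ i, Real.exp (θ * u t ω i ^ 2)) P :=
    (integrable_finsetSum _ fun i _ => hint i).const_mul _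
  have hint2 : Integrable (fun ω => Real.exp (θ / p * euclNorm (u t ω) ^ 2)) P := by
    refine hsum.mono' ?_ (Eventually.of_forall fun ω => ?_)
    · have hm : Measurable fun ω => euclNorm (u t ω) := measurable_euclNorm.comp (hu.measurable t)
      exact (Real.measurable_exp.comp ((hm.pow_const 2).const_mul _)).aestronglyMeasurable
    · rw [Real.norm_of_nonneg (Real.exp_pos _).le]
      exact hconv ω
  have hmgf : mgf (fun ω => euclNorm (u t ω) ^ 2) P (θ / p) ≤ 2 := by
    calc _ ≤ ∫ ω, (p : ℝ)⁻¹ * ∑ i, Real.exp (θ * u t ω i ^ 2) ∂P := integral_mono hint2 hsum hconv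
      _ = (p : ℝ)⁻¹ * ∑ i, ∫ ω, Real.exp (θ * u t ω i ^ 2) ∂P := by
          rw [integral_const_mul, integral_finsetSum _ fun i _ => hint i]
      _ ≤ (p : ℝ)⁻¹ * ∑ _i : Fin p, 2 := by
          gcongr
          exact hle _
      _ = 2 := by
          simp only [Finset.sum_const, Finset.card_univ, Fintype.card_fin, nsmul_eq_mul]
          field_simp
  have hch := measure_ge_le_exp_mul_mgf (X := fun ω => euclNorm (u t ω) ^ 2) (μ := P)
    (t := θ / p) (a ^ 2 * p) (by positivity) hint2
  refine ofReal_measureReal_le ?_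
  calc _ ≤ P.real {ω | a ^ 2 * p ≤ euclNorm (u t ω) ^ 2} := by
        refine measureReal_mono (fun ω hω => ?_) (measure_ne_top _ _)
        have h1 : a * √p < euclNorm (u t ω) := hω
        have h2 := pow_le_pow_left₀ (by positivity) h1.le 2
        rwa [mul_pow, Real.sq_sqrt hp0.le] at h2
    _ ≤ _ := hch
    _ ≤ Real.exp (-(θ / p) * (a ^ 2 * p)) * 2 := by gcongr
    _ = _ := by
        rw [mul_comm]
        congr 2
        rw [hθ]
        field_simp

end IsGaussianNoise

end Noise

/-! ### Finite-dimensional spaces of functions and point evaluations -/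

section PointFunctional

/-- The linear combination of point evaluations `f ↦ ∑ r, d r * f r`. -/
noncomputable def pointFunctional {I : Type*} (d : I →₀ ℝ) (f : I → ℝ) : ℝ :=
  d.sum fun r c => c * f r

/-- On a finite-dimensional space of functions the point evaluations span the dual space. -/
lemma exists_pointFunctional_eq {I : Type*} (V : Submodule ℝ (I → ℝ)) [Module.Finite ℝ V]
    (f : Module.Dual ℝ V) : ∃ d : I →₀ ℝ, ∀ v : V, f v = pointFunctional d v := by
  set ev : I → Module.Dual ℝ V := fun r => (LinearMap.proj r).comp V.subtype with hev
  have htop : Submodule.span ℝ (Set.range ev) = ⊤ := by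
    have h0 : (Submodule.span ℝ (Set.range ev)).dualCoannihilator = ⊥ := by
      rw [Submodule.eq_bot_iff]
      intro v hv
      rw [Submodule.mem_dualCoannihilator] at hv
      ext r
      exact hv (ev r) (Submodule.subset_span ⟨r, rfl⟩)
    rw [← Subspace.dualCoannihilator_dualAnnihilator_eq
      (W := Submodule.span ℝ (Set.range ev)), h0, Submodule.dualAnnihilator_bot]
  obtain ⟨d, hd⟩ := Finsupp.mem_span_range_iff_exists_finsupp.1
    (show f ∈ Submodule.span ℝ (Set.range ev) from htop ▸ Submodule.mem_top)
  refine ⟨d, fun v => ?_⟩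
  rw [← hd, Finsupp.sum, LinearMap.sum_apply]
  rfl

lemma exists_pointFunctional_basis {I ι : Type*} [Fintype ι] (V : Submodule ℝ (I → ℝ))
    (b : Module.Basis ι ℝ V) :
    ∃ d : ι → I →₀ ℝ, ∀ f ∈ V, f = ∑ i, pointFunctional (d i) f • (b i : I → ℝ) := by
  have : Module.Finite ℝ V := Module.Finite.of_basis b
  choose d hd using fun i => exists_pointFunctional_eq V (b.coord i)
  refine ⟨d, fun f hf => ?_⟩
  have h := congrArg (V.subtype) (b.sum_repr ⟨f, hf⟩)
  rw [map_sum] at h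
  refine h.symm.trans (Finset.sum_congr rfl fun i _ => ?_)
  have := hd i ⟨f, hf⟩
  rw [Module.Basis.coord_apply] at this
  rw [map_smul, this]
  rfl

end PointFunctional

/-! ### Expansion of the signal in the leading eigenfunctions -/

section Expansion

variable {Ω : Type*} [MeasurableSpace Ω] {P : Measure Ω}

lemma covariance_congr_ae {X X' Y Y' : Ω → ℝ} (hX : X =ᵐ[P] X') (hY : Y =ᵐ[P] Y') :
    cov[X, Y; P] = cov[X', Y'; P] := by
  unfold covariance
  rw [integral_congr_ae hX, integral_congr_ae hY]
  refine integral_congr_ae ?_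
  filter_upwards [hX, hY] with ω h1 h2
  rw [h1, h2]

lemma memLp_pointFunctional {I : Type*} {x : Ω → I → ℝ} (hx : ∀ r, MemLp (fun ω => x ω r) 2 P)
    (d : I →₀ ℝ) : MemLp (fun ω => pointFunctional d (x ω)) 2 P :=
  memLp_finsetSum _ fun r _ => (hx r).const_mul _

variable [IsProbabilityMeasure P]

lemma covariance_pointFunctional {I : Type*} {x : Ω → I → ℝ}
    (hx : ∀ r, MemLp (fun ω => x ω r) 2 P) (d : I →₀ ℝ) {Y : Ω → ℝ} (hY : MemLp Y 2 P) :
    cov[fun ω => pointFunctional d (x ω), Y; P]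
      = d.sum fun r c => c * cov[fun ω => x ω r, Y; P] := by
  unfold pointFunctional Finsupp.sum
  rw [covariance_fun_sum_left' (fun r _ => (hx r).const_mul _) hY]
  exact Finset.sum_congr rfl fun r _ => covariance_const_mul_left _

lemma covariance_expansion {I ι : Type*} [Fintype ι] {x : Ω → I → ℝ}
    (hx : ∀ r, MemLp (fun ω => x ω r) 2 P) {d : ι → I →₀ ℝ} {b : ι → I → ℝ}
    (hxb : ∀ᵐ ω ∂P, x ω = ∑ i, pointFunctional (d i) (x ω) • b i) {Y : Ω → ℝ}
    (hY : MemLp Y 2 P) (s : I) :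
    cov[fun ω => x ω s, Y; P] = ∑ i, b i s * cov[fun ω => pointFunctional (d i) (x ω), Y; P] := by
  have h1 : (fun ω => x ω s) =ᵐ[P] fun ω => ∑ i, b i s * pointFunctional (d i) (x ω) := by
    filter_upwards [hxb] with ω hω
    conv_lhs => rw [hω]
    simp [mul_comm]
  rw [covariance_congr_ae h1 (ae_eq_refl Y),
    covariance_fun_sum_left (fun i => (memLp_pointFunctional hx (d i)).const_mul _) hY]
  exact Finset.sum_congr rfl fun i _ => covariance_const_mul_left _

lemma integrable_mul_eigenfunction {K : unitInterval → unitInterval → ℝ}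
    (hK : Continuous (Function.uncurry K)) (s : unitInterval) {ψ : unitInterval → ℝ}
    (hψ : MemLp ψ 2 volume) : Integrable (fun r => K s r * ψ r) := by
  have hc : Continuous (K s) := hK.comp (by fun_prop : Continuous fun r => (s, r))
  have h1 : MemLp (K s) 2 volume :=
    hc.memLp_of_hasCompactSupport (HasCompactSupport.of_compactSpace _)
  exact h1.integrable_mul hψ

/-- Eigenfunctions with nonzero eigenvalue of the covariance operator of a curve with values in `V`
lie in `V`, as the kernel sections `Γ(·, r)` do. -/
lemma eigenfunction_mem {x : Ω → unitInterval → ℝ} (hx : ∀ r, MemLp (fun ω => x ω r) 2 P)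
    (hK : Continuous (Function.uncurry (covKernel P x))) {V : Submodule ℝ (unitInterval → ℝ)}
    [Module.Finite ℝ V] (hV : ∀ᵐ ω ∂P, x ω ∈ V) {μ : ℝ} {ψ : unitInterval → ℝ} (hμ : μ ≠ 0)
    (hψ : IsEigenfunction (covKernel P x) μ ψ) : ψ ∈ V := by
  set b := Module.finBasis ℝ V
  obtain ⟨d, hd⟩ := exists_pointFunctional_basis V b
  have hxb : ∀ᵐ ω ∂P, x ω = ∑ i, pointFunctional (d i) (x ω) • (b i : unitInterval → ℝ) := by
    filter_upwards [hV] with ω hω using hd _ hω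
  have hcov : ∀ i r, cov[fun ω => pointFunctional (d i) (x ω), fun ω => x ω r; P]
      = (d i).sum fun m c => c * covKernel P x m r := fun i r =>
    covariance_pointFunctional hx (d i) (hx r)
  have hint : ∀ i, Integrable fun r =>
      cov[fun ω => pointFunctional (d i) (x ω), fun ω => x ω r; P] * ψ r := by
    intro i
    simp_rw [hcov, Finsupp.sum, Finset.sum_mul, mul_assoc]
    exact integrable_finsetSum _ fun m _ => (integrable_mul_eigenfunction hK m hψ.1).const_mul _
  have hψs : ψ = ∑ i, (μ⁻¹ * ∫ r, cov[fun ω => pointFunctional (d i) (x ω), fun ω => x ω r; P]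
      * ψ r) • (b i : unitInterval → ℝ) := by
    ext s
    have h1 : ∀ r, covKernel P x s r * ψ r = ∑ i, (b i : unitInterval → ℝ) s
        * (cov[fun ω => pointFunctional (d i) (x ω), fun ω => x ω r; P] * ψ r) := by
      intro r
      rw [covKernel, covariance_expansion hx hxb (hx r) s, Finset.sum_mul]
      exact Finset.sum_congr rfl fun i _ => mul_assoc _ _ _
    have h2 := hψ.2 s
    simp_rw [h1] at h2
    rw [integral_finsetSum _ fun i _ => (hint i).const_mul _] at h2
    simp_rw [integral_const_mul] at h2
    rw [← inv_mul_cancel_left₀ hμ (ψ s), ← h2, Finset.mul_sum, Finset.sum_apply]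
    refine Finset.sum_congr rfl fun i _ => ?_
    rw [Pi.smul_apply, smul_eq_mul]
    ring
  rw [hψs]
  exact V.sum_mem fun i _ => V.smul_mem _ (b i).2

lemma integral_sum_mul_eigenfunction {K : unitInterval → unitInterval → ℝ} {L : ℕ}
    {lam : ℕ → ℝ} {φ : ℕ → unitInterval → ℝ} (hφ : IsLeadingEigenfunctions K L lam φ)
    (g : Fin L → ℝ) (l : Fin L) : ∫ s, (∑ k : Fin L, g k * φ k s) * φ l s = g l := by
  have hint : ∀ k : Fin L, Integrable fun s => φ k s * φ l s := fun k =>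
    (hφ.eigen k k.2).1.integrable_mul (hφ.eigen l l.2).1
  simp_rw [Finset.sum_mul, mul_assoc]
  rw [integral_finsetSum _ fun k _ => (hint k).const_mul (g k)]
  simp_rw [integral_const_mul, hφ.orthonormal _ (Fin.is_lt _) _ l.2]
  simp [Fin.val_inj]

/-- A curve with values in a space of dimension `L` is a combination of `L` orthonormal
eigenfunctions with nonzero eigenvalues, at every point and not merely in `L²`. The coefficients are
linear combinations of point evaluations, hence measurable. -/
lemma exists_scores {x : Ω → unitInterval → ℝ} (hx : ∀ r, MemLp (fun ω => x ω r) 2 P)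
    (hK : Continuous (Function.uncurry (covKernel P x))) {L : ℕ}
    {V : Submodule ℝ (unitInterval → ℝ)} [Module.Finite ℝ V] (hfr : Module.finrank ℝ V = L)
    (hV : ∀ᵐ ω ∂P, x ω ∈ V) {lam : ℕ → ℝ} {φ : ℕ → unitInterval → ℝ}
    (hφ : IsLeadingEigenfunctions (covKernel P x) L lam φ) (hlam : ∀ k < L, lam k ≠ 0) :
    ∃ d : Fin L → unitInterval →₀ ℝ,
      (∀ f ∈ V, f = ∑ k : Fin L, pointFunctional (d k) f • φ k) ∧
      ∀ s, ∑ k : Fin L, lam k * φ k s ^ 2 = covKernel P x s s := by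
  set v : Fin L → V := fun k =>
    ⟨φ k, eigenfunction_mem hx hK hV (hlam k k.2) (hφ.eigen k k.2)⟩ with hv
  have hli : LinearIndependent ℝ v := by
    rw [Fintype.linearIndependent_iff]
    intro g hg l
    rw [← integral_sum_mul_eigenfunction hφ g l]
    have h : ∀ s, ∑ k : Fin L, g k * φ k s = 0 := by
      intro s
      have h1 := congrFun (congrArg V.subtype hg) s
      rw [map_sum, Finset.sum_apply] at h1
      exact h1
    simp [h]
  set b := Module.Basis.mk hli (hli.span_eq_top_of_card_eq_finrank' (by simp [hfr])).ge
  obtain ⟨d, hd⟩ := exists_pointFunctional_basis V b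
  have hb : ∀ k, (b k : unitInterval → ℝ) = φ k := by
    intro k
    rw [Module.Basis.mk_apply]
  simp_rw [hb] at hd
  refine ⟨d, hd, fun s => ?_⟩
  have hxb : ∀ᵐ ω ∂P, x ω = ∑ k : Fin L, pointFunctional (d k) (x ω) • φ k := by
    filter_upwards [hV] with ω hω using hd _ hω
  set c : Fin L → ℝ := fun k => cov[fun ω => pointFunctional (d k) (x ω), fun ω => x ω s; P]
  have hexp : ∀ r, covKernel P x s r = ∑ k, c k * φ k r := by
    intro r
    rw [covKernel, covariance_comm, covariance_expansion hx hxb (hx s) r]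
    exact Finset.sum_congr rfl fun k _ => mul_comm _ _
  have hc : ∀ l : Fin L, c l = lam l * φ l s := by
    intro l
    rw [← (hφ.eigen l l.2).2 s]
    simp_rw [hexp]
    exact (integral_sum_mul_eigenfunction hφ c l).symm
  rw [hexp s]
  refine Finset.sum_congr rfl fun k _ => ?_
  rw [hc]
  ring

/-- Parseval's identity for combinations of the leading eigenfunctions. -/
lemma normL2_eq_euclNorm {K : unitInterval → unitInterval → ℝ} {L : ℕ} {lam : ℕ → ℝ}
    {φ : ℕ → unitInterval → ℝ} (hφ : IsLeadingEigenfunctions K L lam φ)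
    {f : unitInterval → ℝ} {g : Fin L → ℝ} (hf : f = ∑ k : Fin L, g k • φ k) :
    normL2 f = ENNReal.ofReal (euclNorm g) := by
  have hf' : ∀ s, f s = ∑ k : Fin L, g k * φ k s := by
    intro s
    rw [hf]
    simp
  have hmem : MemLp f 2 volume := by
    rw [hf]
    exact memLp_finsetSum' _ fun k _ => (hφ.eigen k k.2).1.const_smul (g k)
  have hint : ∫ s, f s ^ 2 = ∑ k, g k ^ 2 := by
    have h1 : ∀ s, f s ^ 2 = ∑ l : Fin L, g l * (f s * φ l s) := by
      intro s
      rw [sq]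
      nth_rewrite 2 [hf' s]
      rw [Finset.mul_sum]
      exact Finset.sum_congr rfl fun l _ => by ring
    simp_rw [h1]
    have hint : ∀ l : Fin L, Integrable fun s => f s * φ l s := fun l =>
      hmem.integrable_mul (hφ.eigen l l.2).1
    rw [integral_finsetSum _ fun l _ => (hint l).const_mul (g l)]
    refine Finset.sum_congr rfl fun l _ => ?_
    rw [integral_const_mul]
    simp_rw [hf']
    rw [integral_sum_mul_eigenfunction hφ g l, sq]
  rw [normL2, hmem.eLpNorm_eq_integral_rpow_norm two_ne_zero ENNReal.ofNat_ne_top]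
  congr 1
  simp only [ENNReal.toReal_ofNat, Real.rpow_ofNat, Real.norm_eq_abs, sq_abs]
  rw [hint, euclNorm, Real.sqrt_eq_rpow]
  norm_num

end Expansion

/-! ### Stationarity -/

section Stationarity

universe w v

variable {Ω : Type w} [MeasurableSpace Ω] {P : Measure Ω} [IsProbabilityMeasure P]

lemma identDistrib_past {S : Type v} [MeasurableSpace S] {δ : ℤ → Ω → S}
    (hm : ∀ t, Measurable (δ t)) (hind : iIndepFun δ P)
    (hid : ∀ t, IdentDistrib (δ t) (δ 0) P P) (t : ℤ) :
    IdentDistrib (past δ t) (past δ 0) P P := by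
  have hpast : ∀ t, Measurable (past δ t) := fun t => measurable_pi_lambda _ fun k => hm _
  have hmap : ∀ t, P.map (past δ t) = Measure.infinitePi fun _ : ℕ => P.map (δ 0) := by
    intro t
    have hinj : Function.Injective fun k : ℕ => t - (k : ℤ) := by
      intro a b h
      simpa using h
    have h1 := (iIndepFun_iff_map_fun_eq_infinitePi_map
      (X := fun k : ℕ => δ (t - k)) fun k => hm _).1 (hind.precomp hinj)
    refine h1.trans ?_
    congr 1
    ext1 k
    exact (hid _).map_eq
  exact ⟨(hpast t).aemeasurable, (hpast 0).aemeasurable, by rw [hmap, hmap]⟩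

/-- Approximable sequences are stationary: linear combinations of point evaluations have the same
law at all times. -/
lemma LrMApproximable.identDistrib {r : ℝ} {C : ℝ≥0} {X : ℕ → Ω → unitInterval → ℝ}
    (hX : LrMApproximable.{w, v} P r C X) {ι : Type*} [Finite ι] (d : ι → unitInterval →₀ ℝ)
    (t : ℕ) :
    IdentDistrib (fun ω i => pointFunctional (d i) (X t ω))
      (fun ω i => pointFunctional (d i) (X 0 ω)) P P := by
  obtain ⟨S, _, δ, g, hm, hind, hid, hg, hXg, -⟩ := hX
  have hΨ : Measurable fun a : ℕ → S => fun i => pointFunctional (d i) (g a) := by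
    refine measurable_pi_lambda _ fun i => Finset.measurable_sum _ fun s _ => ?_
    exact (hg.comp (measurable_id.prodMk measurable_const)).const_mul _
  have h := (identDistrib_past hm hind hid (t : ℤ)).comp hΨ
  have hae : ∀ t : ℕ, ((fun a : ℕ → S => fun i => pointFunctional (d i) (g a)) ∘ past δ t)
      =ᵐ[P] fun ω i => pointFunctional (d i) (X t ω) := by
    intro t
    filter_upwards [hXg t] with ω hω
    rw [hω]
    rfl
  have hm' : ∀ t : ℤ, Measurable
      ((fun a : ℕ → S => fun i => pointFunctional (d i) (g a)) ∘ past δ t) := fun t =>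
    hΨ.comp (measurable_pi_lambda _ fun k => hm _)
  have h0 := hae 0
  rw [Nat.cast_zero] at h0
  exact (IdentDistrib.of_ae_eq (hm' t).aemeasurable (hae t)).symm.trans
    (h.trans (IdentDistrib.of_ae_eq (hm' 0).aemeasurable h0))

end Stationarity

/-! ### Moments of the scores -/

section Scores

universe w v

variable {Ω : Type w} [MeasurableSpace Ω] {P : Measure Ω}

lemma measurable_pointFunctional {I : Type*} (d : I →₀ ℝ) :
    Measurable fun f : I → ℝ => pointFunctional d f :=
  Finset.measurable_sum _ fun r _ => (measurable_pi_apply r).const_mul _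

lemma memLp_two_of_lintegral_iSup_le {I : Type*} [MeasurableSpace I] {x : Ω → I → ℝ}
    (hm : Measurable (Function.uncurry x)) {C : ℝ≥0}
    (hC : ∫⁻ ω, ⨆ s, ‖x ω s‖ₑ ^ 2 ∂P ≤ C) (r : I) : MemLp (fun ω => x ω r) 2 P := by
  have hmr : Measurable fun ω => x ω r := hm.comp (measurable_id.prodMk measurable_const)
  refine ⟨hmr.aestronglyMeasurable, ?_⟩
  have h1 : eLpNorm (fun ω => x ω r) 2 P ^ 2 ≤ C := by
    have h2 := eLpNorm_nnreal_pow_eq_lintegral (f := fun ω => x ω r) (μ := P) (p := 2) two_ne_zero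
    simp only [NNReal.coe_ofNat, ENNReal.coe_ofNat, ENNReal.rpow_ofNat] at h2
    rw [h2]
    exact (lintegral_mono fun ω => le_iSup (fun s => ‖x ω s‖ₑ ^ 2) r).trans hC
  exact (ENNReal.pow_lt_top_iff.1 (h1.trans_lt ENNReal.coe_lt_top)).resolve_right two_ne_zero

lemma covKernel_self_le [IsProbabilityMeasure P] {x : Ω → unitInterval → ℝ}
    (hm : Measurable (Function.uncurry x)) {C : ℝ≥0}
    (hC : ∫⁻ ω, ⨆ s, ‖x ω s‖ₑ ^ 2 ∂P ≤ C) (s : unitInterval) : covKernel P x s s ≤ C := by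
  have hmem := memLp_two_of_lintegral_iSup_le hm hC s
  rw [covKernel, covariance_self hmem.aemeasurable]
  refine (variance_le_expectation_sq hmem.aestronglyMeasurable).trans ?_
  have h1 : ∀ ω, ENNReal.ofReal (x ω s ^ 2) = ‖x ω s‖ₑ ^ 2 := by
    intro ω
    rw [← Real.enorm_of_nonneg (sq_nonneg _), enorm_pow]
  simp only [Pi.pow_apply]
  rw [integral_eq_lintegral_of_nonneg_ae (Eventually.of_forall fun ω => sq_nonneg _)
    (hmem.aestronglyMeasurable.pow 2)]
  simp_rw [h1]
  exact ENNReal.toReal_le_coe_of_le_coe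
    ((lintegral_mono fun ω => le_iSup (fun s => ‖x ω s‖ₑ ^ 2) s).trans hC)

lemma normL2_sq_le_iSup (f : unitInterval → ℝ) : normL2 f ^ 2 ≤ ⨆ s, ‖f s‖ₑ ^ 2 := by
  have h2 := eLpNorm_nnreal_pow_eq_lintegral (f := f) (μ := volume) (p := 2) two_ne_zero
  simp only [NNReal.coe_ofNat, ENNReal.coe_ofNat, ENNReal.rpow_ofNat] at h2
  rw [normL2, h2]
  calc ∫⁻ s, ‖f s‖ₑ ^ 2 ≤ ∫⁻ _ : unitInterval, ⨆ s, ‖f s‖ₑ ^ 2 :=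
        lintegral_mono fun s => le_iSup (fun s => ‖f s‖ₑ ^ 2) s
    _ = _ := by simp

/-- The scores of a sequence of curves, given by linear combinations `d k` of point evaluations. For
the `d` of `exists_scores`, the `k`-th score at time `t` is the coefficient of `X t` at the `k`-th
eigenfunction. -/
noncomputable def scores {L : ℕ} (d : Fin L → unitInterval →₀ ℝ) (X : ℕ → Ω → unitInterval → ℝ)
    (t : ℕ) (ω : Ω) (k : Fin L) : ℝ := pointFunctional (d k) (X t ω)

/-- Moments of the `L²`-norm of the first curve are moments of all score vectors. -/
lemma lintegral_euclNorm_scores_le [IsProbabilityMeasure P] {r : ℝ} {C₀ : ℝ≥0} {L : ℕ}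
    {X : ℕ → Ω → unitInterval → ℝ} (hX : LrMApproximable.{w, v} P r C₀ X)
    {V : Submodule ℝ (unitInterval → ℝ)} (hV : ∀ᵐ ω ∂P, X 0 ω ∈ V)
    {K : unitInterval → unitInterval → ℝ} {lam : ℕ → ℝ} {φ : ℕ → unitInterval → ℝ}
    (hφ : IsLeadingEigenfunctions K L lam φ) {d : Fin L → unitInterval →₀ ℝ}
    (hd : ∀ f ∈ V, f = ∑ k : Fin L, pointFunctional (d k) f • φ k) (q : ℝ) {C : ℝ≥0∞}
    (hC : ∫⁻ ω, normL2 (X 0 ω) ^ q ∂P ≤ C) (t : ℕ) :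
    ∫⁻ ω, ENNReal.ofReal (euclNorm (scores d X t ω)) ^ q ∂P ≤ C := by
  have hm : Measurable fun y : Fin L → ℝ => ENNReal.ofReal (euclNorm y) ^ q :=
    (ENNReal.measurable_ofReal.comp measurable_euclNorm).pow_const q
  have h1 : ∫⁻ ω, ENNReal.ofReal (euclNorm (scores d X t ω)) ^ q ∂P
      = ∫⁻ ω, ENNReal.ofReal (euclNorm (scores d X 0 ω)) ^ q ∂P :=
    ((hX.identDistrib d t).comp hm).lintegral_eq
  rw [h1]
  refine (lintegral_mono_ae ?_).trans hC
  filter_upwards [hV] with ω hω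
  rw [normL2_eq_euclNorm hφ (hd _ hω)]
  rfl

/-- Markov's inequality for the norms of random vectors. -/
lemma measure_euclNorm_gt_le_of_lintegral_le {n : Type*} [Fintype n] {Z : Ω → n → ℝ}
    (hZ : AEMeasurable Z P) {q : ℝ} (hq : 0 < q) {C : ℝ≥0}
    (hC : ∫⁻ ω, ENNReal.ofReal (euclNorm (Z ω)) ^ q ∂P ≤ C) {h : ℝ} (hh : 0 < h) :
    P {ω | h < euclNorm (Z ω)} ≤ ENNReal.ofReal (C / h ^ q) := by
  have hm : AEMeasurable (fun ω => ENNReal.ofReal (euclNorm (Z ω)) ^ q) P :=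
    ((ENNReal.measurable_ofReal.comp measurable_euclNorm).pow_const q).comp_aemeasurable hZ
  have hε : ENNReal.ofReal h ^ q = ENNReal.ofReal (h ^ q) :=
    ENNReal.ofReal_rpow_of_pos hh
  have hpos : 0 < h ^ q := Real.rpow_pos_of_pos hh q
  have h1 := meas_ge_le_lintegral_div hm (ε := ENNReal.ofReal h ^ q)
    (by rw [hε]; exact (ENNReal.ofReal_pos.2 hpos).ne') (by rw [hε]; exact ENNReal.ofReal_ne_top)
  calc P {ω | h < euclNorm (Z ω)}
      ≤ P {ω | ENNReal.ofReal h ^ q ≤ ENNReal.ofReal (euclNorm (Z ω)) ^ q} := by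
        refine measure_mono fun ω hω => ?_
        exact ENNReal.rpow_le_rpow (ENNReal.ofReal_le_ofReal (le_of_lt hω)) hq.le
    _ ≤ _ := h1
    _ ≤ C / ENNReal.ofReal (h ^ q) := by rw [hε]; gcongr
    _ = _ := by
        rw [ENNReal.ofReal_div_of_pos hpos, ENNReal.ofReal_coe_nnreal]

end Scores

/-! ### Typical data have probability close to one -/

section Typical

variable {Ω : Type*} [MeasurableSpace Ω] {P : Measure Ω}

lemma measure_exists_le {ι : Type*} [Fintype ι] {S : ι → Set Ω} {δ : ℝ≥0∞}
    (h : ∀ i, P (S i) ≤ δ) : P {ω | ∃ i, ω ∈ S i} ≤ Fintype.card ι * δ := by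
  have h1 : {ω | ∃ i, ω ∈ S i} = ⋃ i, S i := by
    ext ω
    simp
  rw [h1]
  refine (measure_iUnion_fintype_le P S).trans ((Finset.sum_le_sum fun i _ => h i).trans ?_)
  simp

lemma measure_exists_exists_le {ι κ : Type*} [Fintype ι] [Fintype κ] {S : ι → κ → Set Ω}
    {δ : ℝ≥0∞} (h : ∀ i j, P (S i j) ≤ δ) :
    P {ω | ∃ i j, ω ∈ S i j} ≤ Fintype.card ι * Fintype.card κ * δ := by
  rw [mul_assoc]
  exact measure_exists_le fun i => measure_exists_le fun j => h i j

/-- The noise vectors at the first `T` times as the columns of a matrix. -/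
def noiseMatrix {p : ℕ} (T : ℕ) (u : ℕ → Ω → Fin p → ℝ) (ω : Ω) : Matrix (Fin p) (Fin T) ℝ :=
  Matrix.of fun i t => u t ω i

/-- The random vectors `ξ t` at the first `T` times as the rows of a matrix. -/
def scoreMatrix {L : ℕ} (T : ℕ) (ξ : ℕ → Ω → Fin L → ℝ) (ω : Ω) : Matrix (Fin T) (Fin L) ℝ :=
  Matrix.of fun t k => ξ t ω k

variable [IsProbabilityMeasure P]

/-- The probability that the data are not typical. The scores `ξ` only need a second moment and
independence of the noise. -/
lemma measure_not_isTypical_le {p T L : ℕ} {u : ℕ → Ω → Fin p → ℝ} {γ : ℤ → ℝ} {C Cξ : ℝ≥0}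
    (hu : IsGaussianNoise P u γ C) (hC : 1 ≤ C) (hp : 0 < p) (hT : 0 < T)
    {ξ : ℕ → Ω → Fin L → ℝ} (hξm : ∀ t, Measurable (ξ t))
    (hind : IndepFun (fun ω t => u t ω) (fun ω t => ξ t ω) P)
    (hξ : ∀ t, ∫⁻ ω, ENNReal.ofReal (euclNorm (ξ t ω)) ^ (2 : ℝ) ∂P ≤ Cξ)
    (A : Matrix (Fin p) (Fin L) ℝ) {τ θ : ℝ} (hτ : 1 ≤ τ) (hθ : 0 ≤ θ) (hθT : θ ≤ √T) :
    P {ω | ¬ IsTypical A (scoreMatrix T ξ ω) (noiseMatrix T u ω) (fun i j => γ ((i : ℤ) - j)) τ θ}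
      ≤ ENNReal.ofReal (Cξ / τ ^ 2 + 6 * (p ^ 2 * Real.exp (-θ ^ 2 / (128 * C ^ 2)))
        + 6 * (T ^ 2 * Real.exp (-τ ^ 2 / (128 * C ^ 2)))) := by
  have hτ0 : 0 < τ := by linarith
  have hT0 : (0 : ℝ) < T := by exact_mod_cast hT
  have hC1 : (1 : ℝ) ≤ C := hC
  have hC0 : (0 : ℝ) < C := by linarith
  have hCpos : 0 < C := lt_of_lt_of_le one_pos hC
  have hind' := hind.symm
  set X : Ω → Matrix (Fin p) (Fin T) ℝ := fun ω => A * (scoreMatrix T ξ ω)ᵀ with hX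
  have hXm : ∀ i t, Measurable fun y : ℕ → Fin L → ℝ => ∑ k, A i k * y t k := by
    intro i t
    fun_prop
  -- all Gaussian tails are dominated by the weakest one
  have hexp : ∀ {a b : ℝ}, 0 < b → b ≤ 128 * C ^ 2 →
      Real.exp (-a ^ 2 / b) ≤ Real.exp (-a ^ 2 / (128 * C ^ 2)) := by
    intro a b hb hbC
    rw [Real.exp_le_exp, neg_div, neg_div, neg_le_neg_iff]
    gcongr
  set e₁ := Real.exp (-θ ^ 2 / (128 * C ^ 2)) with he₁
  set e₂ := Real.exp (-τ ^ 2 / (128 * C ^ 2)) with he₂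
  have h2C : 2 * (C : ℝ) ≤ 128 * C ^ 2 := by nlinarith
  have h4C : 4 * (C : ℝ) ≤ 128 * C ^ 2 := by nlinarith
  have hscores : P {ω | τ * √T < frobNorm (scoreMatrix T ξ ω)} ≤ ENNReal.ofReal (Cξ / τ ^ 2) := by
    have hm : AEMeasurable (fun ω => ENNReal.ofReal (frobNorm (scoreMatrix T ξ ω) ^ 2)) P := by
      simp_rw [frobNorm_sq_eq_sum]
      refine (ENNReal.measurable_ofReal.comp (Finset.measurable_sum _ fun t _ => ?_)).aemeasurable
      exact (measurable_euclNorm.comp (hξm t)).pow_const 2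
    have hint : ∫⁻ ω, ENNReal.ofReal (frobNorm (scoreMatrix T ξ ω) ^ 2) ∂P ≤ T * Cξ := by
      have h1 : ∀ ω, ENNReal.ofReal (frobNorm (scoreMatrix T ξ ω) ^ 2)
          = ∑ t : Fin T, ENNReal.ofReal (euclNorm (ξ t ω)) ^ (2 : ℝ) := by
        intro ω
        rw [frobNorm_sq_eq_sum, ENNReal.ofReal_sum_of_nonneg fun _ _ => sq_nonneg _]
        refine Finset.sum_congr rfl fun t _ => ?_
        rw [ENNReal.rpow_ofNat, ENNReal.ofReal_pow (euclNorm_nonneg _)]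
        rfl
      simp_rw [h1]
      have h2 : ∀ t, Measurable fun ω => ENNReal.ofReal (euclNorm (ξ t ω)) ^ (2 : ℝ) := fun t =>
        (ENNReal.measurable_ofReal.comp (measurable_euclNorm.comp (hξm t))).pow_const _
      rw [lintegral_finsetSum _ fun (t : Fin T) _ => h2 t]
      refine (Finset.sum_le_sum fun (t : Fin T) _ => hξ t).trans ?_
      simp
    have hpos : 0 < τ ^ 2 * (T : ℝ) := by positivity
    have h1 := meas_ge_le_lintegral_div hm (ε := ENNReal.ofReal (τ ^ 2 * T))
      (ENNReal.ofReal_pos.2 hpos).ne' ENNReal.ofReal_ne_top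
    calc _ ≤ P {ω | ENNReal.ofReal (τ ^ 2 * T)
            ≤ ENNReal.ofReal (frobNorm (scoreMatrix T ξ ω) ^ 2)} := by
          refine measure_mono fun ω hω => ENNReal.ofReal_le_ofReal ?_
          have h2 := pow_le_pow_left₀ (by positivity)
            (le_of_lt (show τ * √T < frobNorm (scoreMatrix T ξ ω) from hω)) 2
          rwa [mul_pow, Real.sq_sqrt hT0.le] at h2
      _ ≤ _ := h1
      _ ≤ (T * Cξ) / ENNReal.ofReal (τ ^ 2 * T) := by gcongr
      _ = ENNReal.ofReal (T * Cξ / (τ ^ 2 * T)) := by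
          rw [ENNReal.ofReal_div_of_pos hpos, ENNReal.ofReal_mul hT0.le, ENNReal.ofReal_natCast,
            ENNReal.ofReal_coe_nnreal]
      _ = _ := by
          congr 1
          field_simp
  have hrow_signal : P {ω | ∃ i j, ω ∈ {ω | θ * euclNorm (X ω i) < |X ω i ⬝ᵥ noiseMatrix T u ω j|}}
      ≤ Fintype.card (Fin p) * Fintype.card (Fin p) * ENNReal.ofReal (2 * e₁) := by
    refine measure_exists_exists_le fun i j => ?_
    have h1 : IndepFun (fun ω => X ω i) (fun ω => noiseMatrix T u ω j) P :=
      hind'.comp (φ := fun (y : ℕ → Fin L → ℝ) (t : Fin T) => ∑ k, A i k * y t k)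
        (ψ := fun (z : ℕ → Fin p → ℝ) (t : Fin T) => z t j)
        (measurable_pi_lambda _ fun t => hXm i t) (by fun_prop)
    have hZ : Measurable fun ω => X ω i := measurable_pi_lambda _ fun t =>
      (hXm i t).comp (measurable_pi_lambda _ fun t => hξm t)
    have hW : Measurable fun ω => noiseMatrix T u ω j :=
      measurable_pi_lambda _ fun t => hu.measurable_coord t j
    refine (measure_mul_euclNorm_lt_abs_dotProduct_le hZ hW h1 hCpos
      (fun x => hu.hasSubgaussianMGF_row j x) hθ).trans (ENNReal.ofReal_le_ofReal ?_)
    gcongr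
    exact hexp (by positivity) h2C
  have hrow_noise : P {ω | ∃ i j, ω ∈ {ω | √T * θ < |noiseMatrix T u ω i ⬝ᵥ noiseMatrix T u ω j
      - T * γ ((i : ℤ) - j)|}}
      ≤ Fintype.card (Fin p) * Fintype.card (Fin p) * ENNReal.ofReal (4 * e₁) :=
    measure_exists_exists_le fun i j => hu.measure_row_product_le hC T i j hθ hθT
  have hcol_signal : P {ω | ∃ r t, ω ∈ {ω | τ * euclNorm ((X ω).col r)
      < |(X ω).col r ⬝ᵥ (noiseMatrix T u ω).col t|}}
      ≤ Fintype.card (Fin T) * Fintype.card (Fin T) * ENNReal.ofReal (2 * e₂) := by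
    refine measure_exists_exists_le fun r t => ?_
    have h1 : IndepFun (fun ω => (X ω).col r) (u t) P :=
      hind'.comp (φ := fun (y : ℕ → Fin L → ℝ) i => ∑ k, A i k * y r k)
        (ψ := fun z : ℕ → Fin p → ℝ => z t)
        (measurable_pi_lambda _ fun i => hXm i r) (measurable_pi_apply _)
    have hZ : Measurable fun ω => (X ω).col r := measurable_pi_lambda _ fun i =>
      (hXm i r).comp (measurable_pi_lambda _ fun t => hξm t)
    refine (measure_mul_euclNorm_lt_abs_dotProduct_le hZ (hu.measurable t) h1 hCpos
      (fun x => hu.hasSubgaussianMGF_dotProduct t x) hτ0.le).trans (ENNReal.ofReal_le_ofReal ?_)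
    gcongr
    exact hexp (by positivity) h2C
  have hcol_noise : P {ω | ∃ r t : Fin T, ω ∈ {ω | r ≠ t ∧ τ * euclNorm ((noiseMatrix T u ω).col r)
      < |(noiseMatrix T u ω).col r ⬝ᵥ (noiseMatrix T u ω).col t|}}
      ≤ Fintype.card (Fin T) * Fintype.card (Fin T) * ENNReal.ofReal (2 * e₂) := by
    refine measure_exists_exists_le fun r t => ?_
    rcases eq_or_ne r t with hrt | hrt
    · simp [hrt]
    have h1 : IndepFun (u r) (u t) P := hu.indep.indepFun fun h => hrt (Fin.ext h)
    refine (measure_mono fun ω hω => ?_).trans ((measure_mul_euclNorm_lt_abs_dotProduct_le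
      (hu.measurable r) (hu.measurable t) h1 hCpos
      (fun x => hu.hasSubgaussianMGF_dotProduct t x) hτ0.le).trans (ENNReal.ofReal_le_ofReal ?_))
    · exact hω.2
    · gcongr
      exact hexp (by positivity) h2C
  have hnorm : P {ω | ∃ t, ω ∈ {ω | τ * √p < euclNorm ((noiseMatrix T u ω).col t)}}
      ≤ Fintype.card (Fin T) * ENNReal.ofReal (2 * e₂) := by
    refine measure_exists_le fun t => ?_
    refine (hu.measure_euclNorm_gt_le hC hp t hτ0.le).trans (ENNReal.ofReal_le_ofReal ?_)
    gcongr
    exact hexp (by positivity) h4C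
  refine (measure_mono fun ω hω => ?_).trans (((measure_union_le _ _).trans (add_le_add hscores
    ((measure_union_le _ _).trans (add_le_add hrow_signal ((measure_union_le _ _).trans
    (add_le_add hrow_noise ((measure_union_le _ _).trans (add_le_add hcol_signal
    ((measure_union_le _ _).trans (add_le_add hcol_noise hnorm)))))))))).trans ?_)
  · by_contra hnot
    simp only [Set.mem_union, Set.mem_ofPred_eq, not_or, not_exists, not_and, not_lt] at hnot
    obtain ⟨h1, h2, h3, h4, h5, h6⟩ := hnot
    exact hω ⟨h1, h2, h3, h4, h5, h6⟩
  · have hT1 : (T : ℝ) ≤ T ^ 2 := by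
      have : (1 : ℝ) ≤ T := by exact_mod_cast hT
      nlinarith
    have he₁0 : 0 ≤ e₁ := (Real.exp_pos _).le
    have he₂0 : 0 ≤ e₂ := (Real.exp_pos _).le
    simp only [Fintype.card_fin]
    rw [← ENNReal.ofReal_natCast p, ← ENNReal.ofReal_natCast T]
    simp only [← ENNReal.ofReal_mul, Nat.cast_nonneg, mul_nonneg]
    repeat rw [← ENNReal.ofReal_add (by positivity) (by positivity)]
    refine ENNReal.ofReal_le_ofReal ?_
    nlinarith [mul_le_mul_of_nonneg_right hT1 he₂0]

end Typical

/-! ### The error on typical data -/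

section Error

lemma euclNorm_mulVec_le_of_abs_gram_le {p L : ℕ} {A : Matrix (Fin p) (Fin L) ℝ} {c : ℝ}
    (hA : ∀ k l, |∑ i, A i k * A i l| ≤ c) (b : Fin L → ℝ) :
    euclNorm (A *ᵥ b) ^ 2 ≤ c * L * euclNorm b ^ 2 := by
  rcases Nat.eq_zero_or_pos L with rfl | hL
  · simp [euclNorm_sq]
  have hc : 0 ≤ c := (abs_nonneg _).trans (hA ⟨0, hL⟩ ⟨0, hL⟩)
  have h1 : euclNorm (A *ᵥ b) ^ 2 = ∑ k, ∑ l, b k * b l * ∑ i, A i k * A i l := by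
    simp_rw [euclNorm_sq, Matrix.mulVec, dotProduct, sq, Finset.sum_mul_sum, Finset.mul_sum]
    rw [Finset.sum_comm]
    refine Finset.sum_congr rfl fun k _ => ?_
    rw [Finset.sum_comm]
    refine Finset.sum_congr rfl fun l _ => Finset.sum_congr rfl fun i _ => ?_
    ring
  have h2 : (∑ k, |b k|) ^ 2 ≤ L * euclNorm b ^ 2 := by
    have := sq_sum_le_card_mul_sum_sq (s := Finset.univ) (f := fun k => |b k|)
    simpa [euclNorm_sq] using this
  calc euclNorm (A *ᵥ b) ^ 2 ≤ ∑ k, ∑ l, |b k| * |b l| * c := by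
        rw [h1]
        refine Finset.sum_le_sum fun k _ => Finset.sum_le_sum fun l _ => ?_
        refine (le_abs_self _).trans ?_
        rw [abs_mul, abs_mul]
        exact mul_le_mul_of_nonneg_left (hA k l) (by positivity)
    _ = c * (∑ k, |b k|) ^ 2 := by
        rw [sq, Finset.sum_mul_sum, Finset.mul_sum]
        refine Finset.sum_congr rfl fun k _ => ?_
        rw [Finset.mul_sum]
        exact Finset.sum_congr rfl fun l _ => mul_comm _ _
    _ ≤ c * (L * euclNorm b ^ 2) := by gcongr
    _ = _ := by ring

/-- The eigenfunctions, evaluated at the sampling points, as the columns of a matrix. -/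
def samplingMatrix {p : ℕ} (L : ℕ) (s : Fin p → unitInterval) (φ : ℕ → unitInterval → ℝ) :
    Matrix (Fin p) (Fin L) ℝ :=
  Matrix.of fun i k => φ k (s i)

lemma maxError_le_of_isTypical {p T L : ℕ} (hp : 0 < p) (hT : 0 < T) {s : Fin p → unitInterval}
    {x : ℕ → unitInterval → ℝ} {u : ℕ → Fin p → ℝ} {φ : ℕ → unitInterval → ℝ}
    {ξ : ℕ → Fin L → ℝ} (hx : ∀ t, x t = ∑ k : Fin L, ξ t k • φ k)
    {Γ : Fin p → Fin p → ℝ} {τ θ h : ℝ} (hτ : 1 ≤ τ) (hθ : 1 ≤ θ) (hh : 1 ≤ h)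
    (htyp : IsTypical (samplingMatrix L s φ) (Matrix.of fun (t : Fin T) k => ξ t k)
      (Matrix.of fun i (t : Fin T) => u t i) Γ τ θ)
    (hL : L ≤ τ) (hA : ∀ r, ∑ k : Fin L, φ k r ^ 2 ≤ τ ^ 2)
    (hgrid : ∀ b, euclNorm (samplingMatrix L s φ *ᵥ b) ≤ τ * √p * euclNorm b)
    (hΓ : ∀ j, ∑ i, Γ i j ^ 2 ≤ τ) {gam : ℕ → ℝ} {e : ℕ → Fin T → ℝ}
    (he : IsLeadingEigenvectors (gramMatrix (dataMatrix T s x u)) L gam e)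
    (hgam : (p : ℝ≥0∞) / ENNReal.ofReal (gam (L - 1)) ≤ ENNReal.ofReal τ)
    {t : Fin T} (ht : euclNorm (ξ t) ≤ h) :
    maxError (recovered (dataMatrix T s x u) L e) s x t
      ≤ ENNReal.ofReal (22 * τ ^ 9 * h * (θ / √T + 1 / √p)) := by
  have hsig : ∀ (i : Fin p) (t : Fin T), x t (s i)
      = (samplingMatrix L s φ * (Matrix.of fun (t : Fin T) k => ξ t k)ᵀ) i t := by
    intro i t
    rw [hx]
    simp [samplingMatrix, Matrix.mul_apply, mul_comm]
  have hY : dataMatrix T s x u = samplingMatrix L s φ * (Matrix.of fun (t : Fin T) k => ξ t k)ᵀ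
      + Matrix.of fun i (t : Fin T) => u t i := by
    ext i t
    rw [Matrix.add_apply, ← hsig]
    rfl
  obtain ⟨hE, c, hc, hcd, heig⟩ := he.exists_inverse_eigenvalues hp hT hgam
  rw [hY] at heig
  refine iSup_le fun j => ENNReal.ofReal_le_ofReal ?_
  rw [hsig, hY]
  refine htyp.abs_error_le hp hT hτ hθ hh hL (fun j => ?_) hgrid hΓ hE hc hcd heig j t ht
  refine le_of_sq_le_sq ?_ (by linarith)
  rw [euclNorm_sq]
  exact hA (s j)

end Error

/-! ### Growth rates -/

section Growth

lemma DivergesSubpolynomially.eventually_le {L : ℕ → ℕ} (hL : DivergesSubpolynomially L)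
    (c : ℝ) {b η : ℝ} (hb : 0 < b) (hη : 0 < η) :
    ∀ᶠ T : ℕ in atTop, c * (L T : ℝ) ^ b ≤ (T : ℝ) ^ η := by
  have h1 := (hL.2 (η / (2 * b)) (by positivity)).bound (show (0 : ℝ) < 1 by norm_num)
  have h2 := ((tendsto_rpow_atTop (half_pos hη)).comp
    tendsto_natCast_atTop_atTop).eventually_ge_atTop |c|
  filter_upwards [h1, h2] with T h1 h2
  have hT : (0 : ℝ) ≤ T := Nat.cast_nonneg T
  rw [one_mul, Real.norm_of_nonneg (Nat.cast_nonneg _),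
    Real.norm_of_nonneg (Real.rpow_nonneg hT _)] at h1
  have h3 : (L T : ℝ) ^ b ≤ (T : ℝ) ^ (η / 2) := by
    refine (Real.rpow_le_rpow (Nat.cast_nonneg _) h1 hb.le).trans_eq ?_
    rw [← Real.rpow_mul hT]
    congr 1
    field_simp
  calc c * (L T : ℝ) ^ b ≤ |c| * (L T : ℝ) ^ b :=
        mul_le_mul_of_nonneg_right (le_abs_self c) (Real.rpow_nonneg (Nat.cast_nonneg _) _)
    _ ≤ (T : ℝ) ^ (η / 2) * (T : ℝ) ^ (η / 2) := by
        gcongr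
        exact h2
    _ = (T : ℝ) ^ η := by
        rw [← Real.rpow_add' hT (by simpa using hη.ne'), add_halves]

lemma tendsto_sq_mul_exp_neg {a f : ℕ → ℝ} (ha : ∀ᶠ T in atTop, 0 < a T)
    (hf : Tendsto f atTop atTop) (haf : (fun T => Real.log (a T)) =o[atTop] f) {K : ℝ}
    (hK : 0 < K) : Tendsto (fun T => a T ^ 2 * Real.exp (-f T / K)) atTop (𝓝 0) := by
  have h1 : Tendsto (fun T => Real.exp (-(f T / (2 * K)))) atTop (𝓝 0) :=
    Real.tendsto_exp_neg_atTop_nhds_zero.comp (hf.atTop_div_const (by positivity))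
  refine squeeze_zero' ?_ ?_ h1
  · filter_upwards with T
    positivity
  · filter_upwards [ha, haf.bound (show 0 < 1 / (4 * K) by positivity),
      hf.eventually_ge_atTop 0] with T h2 h3 h4
    rw [Real.norm_of_nonneg h4] at h3
    have h5 : a T ^ 2 = Real.exp (2 * Real.log (a T)) := by
      rw [two_mul, Real.exp_add, Real.exp_log h2, sq]
    rw [h5, ← Real.exp_add, Real.exp_le_exp]
    have h6 : Real.log (a T) ≤ 1 / (4 * K) * f T := (le_abs_self _).trans h3
    calc 2 * Real.log (a T) + -f T / K ≤ 2 * (1 / (4 * K) * f T) + -f T / K := by linarith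
      _ = -(f T / (2 * K)) := by
          field_simp
          ring

lemma isLittleO_natCast_rpow_rpow {a b : ℝ} (hab : a < b) :
    (fun T : ℕ => (T : ℝ) ^ a) =o[atTop] fun T : ℕ => (T : ℝ) ^ b := by
  refine isLittleO_of_tendsto' ?_ ?_
  · filter_upwards [eventually_gt_atTop 0] with T hT h
    have hT' : (0 : ℝ) < T := by exact_mod_cast hT
    exact absurd h (Real.rpow_pos_of_pos hT' _).ne'
  · refine ((tendsto_rpow_neg_atTop (sub_pos.2 hab)).comp tendsto_natCast_atTop_atTop).congr' ?_
    filter_upwards [eventually_gt_atTop 0] with T hT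
    have hT' : (0 : ℝ) < T := by exact_mod_cast hT
    rw [Function.comp_apply, neg_sub, Real.rpow_sub hT']

/-- Enlarging the exponent turns `log p = O(T ^ κ)` into `log p = o(T ^ κ)`, so that Gaussian tails
at deviations `T ^ (κ / 2)` survive a union bound over pairs of sampling points. -/
lemma DivergesSubexponentially.exists_exponent {p : ℕ → ℕ} (hp : DivergesSubexponentially p) :
    ∃ κ : ℝ, 0 < κ ∧ κ < 1 / 2 ∧
      (fun T => Real.log (p T)) =o[atTop] fun T : ℕ => (T : ℝ) ^ κ := by
  obtain ⟨κ₀, hκ₀, hO⟩ := hp.2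
  refine ⟨(max κ₀ 0 + 1 / 2) / 2, by positivity, ?_, hO.trans_isLittleO ?_⟩
  · have : max κ₀ 0 < 1 / 2 := max_lt hκ₀ (by norm_num)
    linarith
  · have hlt : κ₀ < (max κ₀ 0 + 1 / 2) / 2 := by
      have h1 := le_max_left κ₀ 0
      rcases le_total κ₀ 0 with h | h
      · rw [max_eq_right h]; linarith
      · rw [max_eq_left h]; linarith
    exact isLittleO_natCast_rpow_rpow hlt

end Growth

/-! ### Uniform error bounds along the sequence of samples -/

section Main

universe w v

variable {Ω : Type w} [MeasurableSpace Ω] {P : Measure Ω}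

/-- One bound for all autocovariance sums, at least `1`. -/
lemma NoiseAssumption.exists_isGaussianNoise {p : ℕ → ℕ} {X : ℕ → ℕ → Ω → unitInterval → ℝ}
    {u : (T : ℕ) → ℕ → Ω → Fin (p T) → ℝ} (hu : NoiseAssumption P p X u) :
    ∃ (γ : ℕ → ℤ → ℝ) (C : ℝ≥0), 1 ≤ C ∧ ∀ T, IsGaussianNoise P (u T) (γ T) C := by
  obtain ⟨γ, C, h⟩ := hu.covariance
  refine ⟨γ, max 1 C.toNNReal, le_max_left _ _, fun T => ?_⟩
  exact
    { measurable := hu.measurable T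
      indep := hu.indep T
      gaussian := hu.gaussian T
      mean_zero := hu.mean_zero T
      summable := (h T).1
      tsum_le := (h T).2.1.trans ((Real.le_coe_toNNReal C).trans
        (by exact_mod_cast le_max_right 1 C.toNNReal))
      covariance := (h T).2.2 }

lemma measurable_scores {L : ℕ} (d : Fin L → unitInterval →₀ ℝ) {X : ℕ → Ω → unitInterval → ℝ}
    (hX : ∀ t, Measurable (Function.uncurry (X t))) (t : ℕ) : Measurable (scores d X t) :=
  measurable_pi_lambda _ fun k => (measurable_pointFunctional (d k)).comp
    (measurable_pi_lambda _ fun _ => (hX t).comp (measurable_id.prodMk measurable_const))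

lemma indepFun_scores {L p : ℕ} (d : Fin L → unitInterval →₀ ℝ)
    {X : ℕ → Ω → unitInterval → ℝ} {u : ℕ → Ω → Fin p → ℝ}
    (h : IndepFun (fun ω t => u t ω) (fun ω t => X t ω) P) :
    IndepFun (fun ω t => u t ω) (fun ω t => scores d X t ω) P :=
  h.comp (ψ := fun (f : ℕ → unitInterval → ℝ) t k => pointFunctional (d k) (f t)) measurable_id
    (measurable_pi_lambda _ fun t => measurable_pi_lambda _ fun k =>
      (measurable_pointFunctional (d k)).comp (measurable_pi_apply t))

variable [IsProbabilityMeasure P]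

/-- The signal, expanded in the leading eigenfunctions. -/
lemma SignalAssumption.exists_scores {L : ℕ → ℕ} {X : ℕ → ℕ → Ω → unitInterval → ℝ}
    (hX : SignalAssumption.{w, v} P L X) {lam : ℕ → ℕ → ℝ} {φ : ℕ → ℕ → unitInterval → ℝ}
    (hφ : ∀ T, IsLeadingEigenfunctions (covKernel P (X T 0)) (L T) (lam T) (φ T))
    (hlam : ∀ T, ∀ k < L T, 0 < lam T k) :
    ∃ (d : (T : ℕ) → Fin (L T) → unitInterval →₀ ℝ) (C : ℝ≥0),
      (∀ T, ∀ᵐ ω ∂P, ∀ t, X T t ω = ∑ k : Fin (L T), scores (d T) (X T) t ω k • φ T k) ∧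
      (∀ T r, ∑ k : Fin (L T), lam T k * φ T k r ^ 2 ≤ C) ∧
      (∀ T t, ∫⁻ ω, ENNReal.ofReal (euclNorm (scores (d T) (X T) t ω)) ^ (2 : ℝ) ∂P ≤ C) ∧
      ∀ T (q : ℝ) (C' : ℝ≥0), ∫⁻ ω, normL2 (X T 0 ω) ^ q ∂P ≤ C' → ∀ t,
        ∫⁻ ω, ENNReal.ofReal (euclNorm (scores (d T) (X T) t ω)) ^ q ∂P ≤ C' := by
  obtain ⟨C, hC⟩ := hX.sup_moment
  obtain ⟨C₀, hC₀⟩ := hX.approximable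
  choose V hVfin hVrank hVmem using hX.finite_dim
  have hmem : ∀ T r, MemLp (fun ω => X T 0 ω r) 2 P := fun T r =>
    memLp_two_of_lintegral_iSup_le (hX.measurable T 0) (hC T) r
  have hex := fun T => FactorFDA.exists_scores (hmem T) (hX.continuous_cov T) (hVrank T)
    (hVmem T 0) (hφ T) fun k hk => (hlam T k hk).ne'
  choose d hd hdiag using hex
  have hq : ∀ T (q : ℝ) (C' : ℝ≥0), ∫⁻ ω, normL2 (X T 0 ω) ^ q ∂P ≤ C' → ∀ t,
      ∫⁻ ω, ENNReal.ofReal (euclNorm (scores (d T) (X T) t ω)) ^ q ∂P ≤ C' := fun T q C' h t =>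
    lintegral_euclNorm_scores_le (hC₀ T) (hVmem T 0) (hφ T) (hd T) q h t
  refine ⟨d, C, fun T => ?_, fun T r => ?_, fun T t => hq T 2 C ?_ t, hq⟩
  · filter_upwards [ae_all_iff.2 (hVmem T)] with ω hω t using hd T _ (hω t)
  · rw [hdiag]
    exact covKernel_self_le (hX.measurable T 0) (hC T) r
  · refine (lintegral_mono fun ω => ?_).trans (hC T)
    rw [ENNReal.rpow_ofNat]
    exact normL2_sq_le_iSup _

/-- The error bound `h * r T` holds at all times `t` with `‖ξ T t‖ ≤ h` simultaneously, up to a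
probability `δ T → 0` that does not depend on `h`. Here `ξ T t` is the score vector at time `t`, and
the growing factor `τ T` is the room that `r T` leaves below the target rate. -/
lemma exists_uniform_error_bound {p L : ℕ → ℕ} {s : (T : ℕ) → Fin (p T) → unitInterval}
    {X : ℕ → ℕ → Ω → unitInterval → ℝ} {u : (T : ℕ) → ℕ → Ω → Fin (p T) → ℝ}
    {lam : ℕ → ℕ → ℝ} {φ : ℕ → ℕ → unitInterval → ℝ}
    {gam : ℕ → Ω → ℕ → ℝ} {e : (T : ℕ) → Ω → ℕ → Fin T → ℝ} {ρ ν β : ℝ}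
    (hnoise : NoiseAssumption P p X u) (hX : ∀ T t, Measurable (Function.uncurry (X T t)))
    (hgrid : GridAssumption p L s φ) (hp : DivergesSubexponentially p)
    (hL : DivergesSubpolynomially L) (hν : 0 < ν) (hρ : 0 < ρ)
    (hlam : ∀ T, ∀ j < L T, ρ * ((j : ℝ) + 1) ^ (-ν) ≤ lam T j)
    (he : ∀ᶠ T in atTop, ∀ ω, IsLeadingEigenvectors
      (gramMatrix (dataMatrix T (s T) (fun t => X T t ω) (fun t => u T t ω)))
      (L T) (gam T ω) (e T ω))
    (hβ : 0 < β)
    (hgam : IsBigOP P (fun T ω => (p T : ℝ≥0∞) / ENNReal.ofReal (gam T ω (L T - 1)))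
      (fun T => (L T : ℝ) ^ β))
    {d : (T : ℕ) → Fin (L T) → unitInterval →₀ ℝ} {C : ℝ≥0}
    (hd : ∀ T, ∀ᵐ ω ∂P, ∀ t, X T t ω = ∑ k : Fin (L T), scores (d T) (X T) t ω k • φ T k)
    (hdiag : ∀ T r, ∑ k : Fin (L T), lam T k * φ T k r ^ 2 ≤ C)
    (hmom : ∀ T t, ∫⁻ ω, ENNReal.ofReal (euclNorm (scores (d T) (X T) t ω)) ^ (2 : ℝ) ∂P ≤ C) :
    ∃ (τ r : ℕ → ℝ) (δ : ℕ → ℝ≥0∞), Tendsto τ atTop atTop ∧ Tendsto δ atTop (𝓝 0) ∧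
      (∀ ε : ℝ, 0 < ε → ∀ᶠ T : ℕ in atTop, τ T * r T ≤
        ε * (1 / (T : ℝ) ^ (1 / 4 : ℝ) + (T : ℝ) ^ (1 / 4 : ℝ) / √(p T : ℝ))) ∧
      ∀ᶠ T in atTop, ∀ h : ℝ, 1 ≤ h →
        P {ω | ∃ t : Fin T, euclNorm (scores (d T) (X T) t ω) ≤ h ∧ ENNReal.ofReal (h * r T) <
          maxError (recovered (dataMatrix T (s T) (fun t => X T t ω) (fun t => u T t ω)) (L T)
            (e T ω)) (s T) (fun t => X T t ω) t} ≤ δ T := by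
  obtain ⟨γ, Cu, hCu, hu⟩ := hnoise.exists_isGaussianNoise
  obtain ⟨κ, hκ0, hκ, hlogp⟩ := hp.exists_exponent
  obtain ⟨Cg, hCg⟩ := hgrid
  -- the room between the exponents `κ / 2 - 1 / 2` and `-1 / 4`, to be shared among twelve factors
  set η := (1 / 4 - κ / 2) / 12 with hη_def
  have hη : 0 < η := by rw [hη_def]; linarith
  set τ : ℕ → ℝ := fun T => (T : ℝ) ^ η with hτ_def
  set θ : ℕ → ℝ := fun T => (T : ℝ) ^ (κ / 2) with hθ_def
  have hτ : Tendsto τ atTop atTop := (tendsto_rpow_atTop hη).comp tendsto_natCast_atTop_atTop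
  have hκ2 : 0 < κ / 2 := by linarith
  have hθ : Tendsto θ atTop atTop := (tendsto_rpow_atTop hκ2).comp tendsto_natCast_atTop_atTop
  have hθsq : ∀ T, θ T ^ 2 = (T : ℝ) ^ κ := by
    intro T
    rw [← Real.rpow_natCast, ← Real.rpow_mul (Nat.cast_nonneg T)]
    congr 1
    push_cast
    ring
  have hτsq : ∀ T, τ T ^ 2 = (T : ℝ) ^ (2 * η) := by
    intro T
    rw [← Real.rpow_natCast, ← Real.rpow_mul (Nat.cast_nonneg T)]
    congr 1
    push_cast
    ring
  have hτθ : ∀ T : ℕ, 0 < T → τ T ^ 12 * θ T = (T : ℝ) ^ (1 / 4 : ℝ) := by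
    intro T hT
    have hT' : (0 : ℝ) < T := by exact_mod_cast hT
    rw [← Real.rpow_natCast, ← Real.rpow_mul hT'.le, ← Real.rpow_add hT']
    congr 1
    rw [hη_def]
    push_cast
    ring
  have hpT : ∀ᶠ T in atTop, 0 < p T := hp.1.eventually_gt_atTop 0
  have hT : ∀ᶠ T : ℕ in atTop, 0 < T := eventually_gt_atTop 0
  have hτ1 : ∀ᶠ T in atTop, 1 ≤ τ T := hτ.eventually_ge_atTop 1
  have hθ1 : ∀ᶠ T in atTop, 1 ≤ θ T := hθ.eventually_ge_atTop 1
  set K : ℝ := 128 * Cu ^ 2 with hK_def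
  have hCu0 : 0 < Cu := lt_of_lt_of_le one_pos hCu
  have hK : 0 < K := by positivity
  set G : ℕ → Set Ω := fun T =>
    {ω | ENNReal.ofReal (τ T) < (p T : ℝ≥0∞) / ENNReal.ofReal (gam T ω (L T - 1))} with hG
  have hGlim : Tendsto (fun T => P (G T)) atTop (𝓝 0) := by
    rw [ENNReal.tendsto_nhds_zero]
    intro ε hε
    obtain ⟨ε', hε', hlt⟩ : ∃ ε' : ℝ, 0 < ε' ∧ ENNReal.ofReal ε' ≤ ε := by
      rcases eq_or_ne ε ⊤ with rfl | htop
      · exact ⟨1, one_pos, le_top⟩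
      · exact ⟨ε.toReal, ENNReal.toReal_pos hε.ne' htop, ENNReal.ofReal_toReal_le⟩
    obtain ⟨M, hM, hev⟩ := hgam ε' hε'
    filter_upwards [hev, hL.eventually_le M hβ hη] with T h1 h2
    refine (measure_mono fun ω hω => ?_).trans (h1.trans hlt)
    exact (ENNReal.ofReal_le_ofReal h2).trans_lt hω
  set D : ℕ → ℝ := fun T => C / τ T ^ 2 + 6 * ((p T : ℝ) ^ 2 * Real.exp (-θ T ^ 2 / K))
    + 6 * ((T : ℝ) ^ 2 * Real.exp (-τ T ^ 2 / K)) with hD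
  have hDlim : Tendsto D atTop (𝓝 0) := by
    have h1 : Tendsto (fun T => (C : ℝ) / τ T ^ 2) atTop (𝓝 0) :=
      tendsto_const_nhds.div_atTop ((tendsto_pow_atTop two_ne_zero).comp hτ)
    have h2 : Tendsto (fun T => (p T : ℝ) ^ 2 * Real.exp (-θ T ^ 2 / K)) atTop (𝓝 0) := by
      refine tendsto_sq_mul_exp_neg (hpT.mono fun T h => by exact_mod_cast h)
        ((tendsto_pow_atTop two_ne_zero).comp hθ) ?_ hK
      refine hlogp.congr_right fun T => ?_
      exact (hθsq T).symm
    have h3 : Tendsto (fun T : ℕ => (T : ℝ) ^ 2 * Real.exp (-τ T ^ 2 / K)) atTop (𝓝 0) := by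
      refine tendsto_sq_mul_exp_neg (hT.mono fun T h => by exact_mod_cast h)
        ((tendsto_pow_atTop two_ne_zero).comp hτ) ?_ hK
      refine ((isLittleO_log_rpow_atTop (show 0 < 2 * η by positivity)).comp_tendsto
        tendsto_natCast_atTop_atTop).congr_right fun T => ?_
      exact (hτsq T).symm
    simpa using (h1.add (h2.const_mul 6)).add (h3.const_mul 6)
  set r : ℕ → ℝ := fun T => 22 * τ T ^ 9 * (θ T / √T + 1 / √(p T)) with hr
  refine ⟨τ, r, fun T => ENNReal.ofReal (D T) + P (G T), hτ, ?_, ?_, ?_⟩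
  · have := (ENNReal.tendsto_ofReal hDlim).add hGlim
    simpa using this
  · intro ε hε
    filter_upwards [hT, hpT, hτ1, hθ1, hτ.eventually_ge_atTop 22, hτ.eventually_ge_atTop (1 / ε)]
      with T hT hpT hτ1 hθ1 h22 hτε
    have hT' : (0 : ℝ) < T := by exact_mod_cast hT
    have hp' : (0 : ℝ) < p T := by exact_mod_cast hpT
    have hτ0 : 0 < τ T := by linarith
    have hθ0 : 0 < θ T := by linarith
    have hS : 0 < √(T : ℝ) := Real.sqrt_pos.2 hT'
    have hQ : 0 < √(p T : ℝ) := Real.sqrt_pos.2 hp'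
    set q := (T : ℝ) ^ (1 / 4 : ℝ) with hq
    have hq0 : 0 < q := Real.rpow_pos_of_pos hT' _
    have hqS : √(T : ℝ) = q * q := by
      rw [hq, ← Real.rpow_add hT', Real.sqrt_eq_rpow]
      norm_num
    have h1 : 22 * τ T ^ 10 ≤ ε * τ T ^ 12 := by
      have h2 : 1 ≤ ε * τ T := by
        have := mul_le_mul_of_nonneg_left hτε hε.le
        rwa [mul_one_div_cancel hε.ne'] at this
      calc 22 * τ T ^ 10 = 22 * 1 * τ T ^ 10 := by ring
        _ ≤ τ T * (ε * τ T) * τ T ^ 10 := by gcongr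
        _ = _ := by ring
    have h3 : τ T ^ 12 ≤ q := by
      rw [hq, ← hτθ T hT]
      exact le_mul_of_one_le_right (by positivity) hθ1
    calc τ T * r T = 22 * τ T ^ 10 * (θ T / √T + 1 / √(p T)) := by
          rw [hr]
          ring
      _ ≤ ε * τ T ^ 12 * (θ T / √T + 1 / √(p T)) := by gcongr
      _ = ε * (τ T ^ 12 * θ T / √T + τ T ^ 12 / √(p T)) := by ring
      _ = ε * (q / (q * q) + τ T ^ 12 / √(p T)) := by rw [hτθ T hT, hqS]
      _ ≤ ε * (q / (q * q) + q / √(p T)) := by gcongr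
      _ = _ := by
          congr 2
          field_simp
  · filter_upwards [hT, hpT, hτ1, hθ1, he, hCg, hL.eventually_le 1 one_pos hη,
      hL.eventually_le Cg one_pos hη, hL.eventually_le (C / ρ) hν hη,
      hτ.eventually_ge_atTop ((Cu : ℝ) ^ 2)]
      with T hT hpT hτ1 hθ1 he hCg hLτ hLg hLν hCuτ h hh
    have hT' : (0 : ℝ) < T := by exact_mod_cast hT
    have hp' : (0 : ℝ) < p T := by exact_mod_cast hpT
    have hτ0 : 0 < τ T := by linarith
    rw [Real.rpow_one] at hLτ hLg
    rw [one_mul] at hLτ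
    have hττ : τ T ≤ τ T ^ 2 := le_self_pow₀ hτ1 two_ne_zero
    have hθT : θ T ≤ √T := by
      rw [Real.sqrt_eq_rpow]
      exact Real.rpow_le_rpow_of_exponent_le (by exact_mod_cast hT) (by linarith)
    have hA : ∀ r, ∑ k : Fin (L T), φ T k r ^ 2 ≤ τ T ^ 2 := by
      intro r
      rcases Nat.eq_zero_or_pos (L T) with h0 | h0
      · have : IsEmpty (Fin (L T)) := by rw [h0]; infer_instance
        simp [sq_nonneg]
      have hL0 : (0 : ℝ) < L T := by exact_mod_cast h0
      have h1 : ∀ k : Fin (L T), φ T k r ^ 2 ≤ (L T : ℝ) ^ ν / ρ * (lam T k * φ T k r ^ 2) := by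
        intro k
        have h2 : ρ * (L T : ℝ) ^ (-ν) ≤ lam T k := by
          refine le_trans ?_ (hlam T k k.2)
          gcongr ?_ * ?_
          refine Real.rpow_le_rpow_of_nonpos (by positivity) ?_ (by linarith)
          exact_mod_cast k.2
        have h3 : 1 ≤ (L T : ℝ) ^ ν / ρ * lam T k := by
          calc 1 = (L T : ℝ) ^ ν / ρ * (ρ * (L T : ℝ) ^ (-ν)) := by
                rw [Real.rpow_neg hL0.le]
                have := (Real.rpow_pos_of_pos hL0 ν).ne'
                field_simp
            _ ≤ _ := by gcongr
        calc φ T k r ^ 2 = 1 * φ T k r ^ 2 := (one_mul _).symm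
          _ ≤ (L T : ℝ) ^ ν / ρ * lam T k * φ T k r ^ 2 := by gcongr
          _ = _ := by ring
      calc ∑ k : Fin (L T), φ T k r ^ 2
          ≤ (L T : ℝ) ^ ν / ρ * ∑ k : Fin (L T), lam T k * φ T k r ^ 2 := by
            rw [Finset.mul_sum]
            exact Finset.sum_le_sum fun k _ => h1 k
        _ ≤ (L T : ℝ) ^ ν / ρ * C := by
            gcongr
            exact hdiag T r
        _ = C / ρ * (L T : ℝ) ^ ν := by ring
        _ ≤ τ T ^ 2 := hLν.trans hττ
    have hgridT : ∀ b, euclNorm (samplingMatrix (L T) (s T) (φ T) *ᵥ b)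
        ≤ τ T * √(p T) * euclNorm b := by
      intro b
      have h1 : ∀ k l : Fin (L T), |∑ i, samplingMatrix (L T) (s T) (φ T) i k
          * samplingMatrix (L T) (s T) (φ T) i l| ≤ Cg * p T := by
        intro k l
        have h2 := hCg k k.2 l l.2
        rw [abs_mul, abs_of_pos (inv_pos.2 hp'), inv_mul_le_iff₀ hp', mul_comm] at h2
        exact h2
      refine le_of_sq_le_sq ((euclNorm_mulVec_le_of_abs_gram_le h1 b).trans ?_)
        (mul_nonneg (by positivity) (euclNorm_nonneg _))
      rw [mul_pow, mul_pow, Real.sq_sqrt hp'.le]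
      calc Cg * p T * L T * euclNorm b ^ 2 = Cg * L T * p T * euclNorm b ^ 2 := by ring
        _ ≤ τ T ^ 2 * p T * euclNorm b ^ 2 := by
            gcongr
            exact hLg.trans hττ
    have hΓ : ∀ j : Fin (p T), ∑ i : Fin (p T), γ T ((i : ℤ) - j) ^ 2 ≤ τ T := fun j =>
      ((hu T).sum_sq_le j).trans hCuτ
    have htyp := measure_not_isTypical_le (hu T) hCu hpT hT
      (measurable_scores (d T) (hX T)) (indepFun_scores (d T) (hnoise.indep_signal T))
      (hmom T) (samplingMatrix (L T) (s T) (φ T)) hτ1 (by linarith) hθT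
    refine (measure_mono_ae (t := {ω | ¬ IsTypical (samplingMatrix (L T) (s T) (φ T))
      (scoreMatrix T (scores (d T) (X T)) ω) (noiseMatrix T (u T) ω)
      (fun i j => γ T ((i : ℤ) - j)) (τ T) (θ T)} ∪ G T) ?_).trans
      ((measure_union_le _ _).trans (add_le_add_left htyp _))
    filter_upwards [hd T] with ω hω hbad
    by_contra hnot
    obtain ⟨h1, h2⟩ := not_or.1 hnot
    rw [Set.mem_ofPred_eq, not_not] at h1
    obtain ⟨t, ht, hlt⟩ := hbad
    refine absurd hlt (not_lt.2 ?_)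
    refine (maxError_le_of_isTypical hpT hT hω hτ1 hθ1 hh h1 hLτ hA hgridT hΓ (he ω)
      (not_lt.1 h2) ht).trans (ENNReal.ofReal_le_ofReal (le_of_eq ?_))
    rw [hr]
    ring

end Main

end FactorFDA

theorem theorem2 {Ω : Type*} [MeasurableSpace Ω] (P : Measure Ω) [IsProbabilityMeasure P]
    -- number of sampling points, dimension of the signal space, sampling points
    (p L : ℕ → ℕ) (s : (T : ℕ) → Fin (p T) → unitInterval)
    -- signals and noise, for each sample size `T`
    (X : ℕ → ℕ → Ω → unitInterval → ℝ) (u : (T : ℕ) → ℕ → Ω → Fin (p T) → ℝ)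
    -- eigenvalues and eigenfunctions of the covariance operator
    (lam : ℕ → ℕ → ℝ) (φ : ℕ → ℕ → unitInterval → ℝ)
    -- leading eigenvalues and eigenvectors of `T⁻¹ Yᵀ Y`
    (gam : ℕ → Ω → ℕ → ℝ) (e : (T : ℕ) → Ω → ℕ → Fin T → ℝ)
    (ρ ν β : ℝ)
    (hs : ∀ T, StrictMono (s T))
    (hnoise : NoiseAssumption P p X u)
    (hsignal : SignalAssumption P L X)
    (hφ : ∀ T, IsLeadingEigenfunctions (covKernel P (X T 0)) (L T) (lam T) (φ T))
    (hgrid : GridAssumption p L s φ)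
    (hp : DivergesSubexponentially p)
    (hL : DivergesSubpolynomially L)
    (hν : 0 < ν) (hρ : 0 < ρ)
    (hlam : ∀ T, ∀ j < L T, ρ * ((j : ℝ) + 1) ^ (-ν) ≤ lam T j)
    (he : ∀ᶠ T in atTop, ∀ ω, IsLeadingEigenvectors
      (gramMatrix (dataMatrix T (s T) (fun t => X T t ω) (fun t => u T t ω)))
      (L T) (gam T ω) (e T ω))
    (hβ : 0 < β)
    (hgam : IsBigOP P (fun T ω => (p T : ℝ≥0∞) / ENNReal.ofReal (gam T ω (L T - 1)))
      (fun T => (L T : ℝ) ^ β)) :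
    IsBigOPForEach P
      (fun T t ω => maxError
        (recovered (dataMatrix T (s T) (fun t => X T t ω) (fun t => u T t ω)) (L T) (e T ω))
        (s T) (fun t => X T t ω) t)
      (fun T => (L T : ℝ) ^ (2 * β + 5 / 2 + ν / 2) *
        (1 / (T : ℝ) ^ (1 / 4 : ℝ) + (T : ℝ) ^ (1 / 4 : ℝ) / √(p T : ℝ))) ∧
    ∀ q : ℝ, 4 < q →
      (∃ C : ℝ≥0, ∀ T, ∫⁻ ω, normL2 (X T 0 ω) ^ q ∂P ≤ C) →
      ∀ q' : ℝ, 0 < q' → q' < q →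
        IsLittleOP P
          (fun T ω => ⨆ t, maxError
            (recovered (dataMatrix T (s T) (fun t => X T t ω) (fun t => u T t ω)) (L T) (e T ω))
            (s T) (fun t => X T t ω) t)
          (fun T => (L T : ℝ) ^ (2 * β + 5 / 2 + ν) * (T : ℝ) ^ (1 / q') *
            (1 / (T : ℝ) ^ (1 / 4 : ℝ) + (T : ℝ) ^ (1 / 4 : ℝ) / √(p T : ℝ))) := by
  have hlam0 : ∀ T, ∀ k < L T, 0 < lam T k := fun T k hk =>
    (mul_pos hρ (Real.rpow_pos_of_pos (by positivity) _)).trans_le (hlam T k hk)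
  obtain ⟨d, C, hd, hdiag, hmom, hmomq⟩ := hsignal.exists_scores hφ hlam0
  obtain ⟨τ, r, δ, hτ, hδ, hrate, hbound⟩ := exists_uniform_error_bound hnoise hsignal.measurable
    hgrid hp hL hν hρ hlam he hβ hgam hd hdiag hmom
  have hξm := fun T t => (measurable_scores (d T) (hsignal.measurable T) t).aemeasurable (μ := P)
  have hLpow : ∀ a : ℝ, 0 < a → ∀ᶠ T in atTop, 1 ≤ (L T : ℝ) ^ a := by
    intro a ha
    filter_upwards [hL.1.eventually_ge_atTop 1] with T hT
    exact Real.one_le_rpow (by exact_mod_cast hT) ha.le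
  constructor
  · intro ε hε
    refine ⟨1, one_pos, ?_⟩
    have hlim : Tendsto (fun T => δ T + ENNReal.ofReal (C / τ T ^ (2 : ℝ))) atTop (𝓝 0) := by
      have h1 : Tendsto (fun T => (C : ℝ) / τ T ^ (2 : ℝ)) atTop (𝓝 0) :=
        tendsto_const_nhds.div_atTop ((tendsto_rpow_atTop two_pos).comp hτ)
      simpa using hδ.add (ENNReal.tendsto_ofReal h1)
    filter_upwards [hbound, hrate 1 one_pos, hτ.eventually_ge_atTop 1,
      hLpow (2 * β + 5 / 2 + ν / 2) (by positivity),
      (ENNReal.tendsto_nhds_zero.1 hlim) _ (ENNReal.ofReal_pos.2 hε)]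
      with T hbound hrate hτ1 hL1 hle t
    refine le_trans ?_ hle
    refine le_trans (measure_mono fun ω hω => ?_) ((measure_union_le _ _).trans
      (add_le_add (hbound (τ T) hτ1) (measure_euclNorm_gt_le_of_lintegral_le (hξm T t) two_pos
        (hmom T t) (show 0 < τ T by linarith))))
    rcases le_or_gt (euclNorm (scores (d T) (X T) t ω)) (τ T) with h | h
    · refine Or.inl ⟨t, h, lt_of_le_of_lt (ENNReal.ofReal_le_ofReal ?_) hω⟩
      rw [one_mul] at hrate ⊢
      exact hrate.trans (le_mul_of_one_le_left (by positivity) hL1)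
    · exact Or.inr h
  · rintro q hq ⟨C', hC'⟩ q' hq' hqq' ε hε
    have hq0 : 0 < q := by linarith
    have hlim : Tendsto (fun T => δ T + ENNReal.ofReal (C' / τ T ^ q)) atTop (𝓝 0) := by
      have h1 : Tendsto (fun T => (C' : ℝ) / τ T ^ q) atTop (𝓝 0) :=
        tendsto_const_nhds.div_atTop ((tendsto_rpow_atTop hq0).comp hτ)
      simpa using hδ.add (ENNReal.tendsto_ofReal h1)
    refine tendsto_of_tendsto_of_tendsto_of_le_of_le' tendsto_const_nhds hlim
      (Eventually.of_forall fun T => zero_le) ?_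
    filter_upwards [hbound, hrate ε hε, hτ.eventually_ge_atTop 1,
      hLpow (2 * β + 5 / 2 + ν) (by positivity), eventually_ge_atTop 1]
      with T hbound hrate hτ1 hL1 hT
    have hT1 : (1 : ℝ) ≤ T := by exact_mod_cast hT
    have hT0 : (0 : ℝ) < T := by linarith
    have hτ0 : 0 < τ T := by linarith
    have hTq : 1 ≤ (T : ℝ) ^ (1 / q) := Real.one_le_rpow hT1 (by positivity)
    -- a `T`-fold union bound costs the factor `T ^ (1 / q)` in the size of the scores
    set h := (T : ℝ) ^ (1 / q) * τ T with hh
    have hh1 : 1 ≤ h := one_le_mul_of_one_le_of_one_le hTq hτ1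
    have hhq : h ^ q = T * τ T ^ q := by
      rw [hh, Real.mul_rpow (by positivity) hτ0.le, ← Real.rpow_mul hT0.le,
        one_div_mul_cancel hq0.ne', Real.rpow_one]
    have hunion : P {ω | ∃ t : Fin T, ω ∈ {ω | h < euclNorm (scores (d T) (X T) t ω)}}
        ≤ ENNReal.ofReal (C' / τ T ^ q) := by
      refine (measure_exists_le fun t : Fin T => measure_euclNorm_gt_le_of_lintegral_le (hξm T t)
        hq0 (hmomq T q C' (hC' T) t) (show 0 < h by linarith)).trans (le_of_eq ?_)
      rw [Fintype.card_fin, ← ENNReal.ofReal_natCast, ← ENNReal.ofReal_mul hT0.le, hhq]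
      congr 1
      have := (Real.rpow_pos_of_pos hτ0 q).ne'
      field_simp
    refine le_trans (measure_mono fun ω hω => ?_) ((measure_union_le _ _).trans
      (add_le_add (hbound h hh1) hunion))
    rw [Set.mem_ofPred_eq] at hω
    obtain ⟨t, ht⟩ := lt_iSup_iff.1 hω
    rcases le_or_gt (euclNorm (scores (d T) (X T) t ω)) h with hle | hgt
    · refine Or.inl ⟨t, hle, lt_of_le_of_lt (ENNReal.ofReal_le_ofReal ?_) ht⟩
      have hqq : (T : ℝ) ^ (1 / q) ≤ (T : ℝ) ^ (1 / q') :=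
        Real.rpow_le_rpow_of_exponent_le hT1 (one_div_le_one_div_of_le hq' hqq'.le)
      set R := 1 / (T : ℝ) ^ (1 / 4 : ℝ) + (T : ℝ) ^ (1 / 4 : ℝ) / √(p T : ℝ) with hR
      have hR0 : 0 ≤ R := by positivity
      calc h * r T = (T : ℝ) ^ (1 / q) * (τ T * r T) := by rw [hh]; ring
        _ ≤ (T : ℝ) ^ (1 / q) * (ε * R) := by gcongr
        _ ≤ (T : ℝ) ^ (1 / q') * (ε * R) := by gcongr
        _ = 1 * ((T : ℝ) ^ (1 / q') * (ε * R)) := (one_mul _).symm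
        _ ≤ (L T : ℝ) ^ (2 * β + 5 / 2 + ν) * ((T : ℝ) ^ (1 / q') * (ε * R)) := by gcongr
        _ = _ := by ring
    · exact Or.inr ⟨t, hgt⟩
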